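/- Let $K$ be a complete non-trivially valued non-Archimedean field; analytic spaces are $K$-analytic spaces in the sense of Berkovich, and $\mathcal{O}$-modules are taken for the G-topology. Let $X$ be an analytic space over an analytic space $S$, let $\Lambda$ be a free abelian group of finite rank, and let $\Lambda \to \mathrm{Pic}(X)$, $\chi \mapsto L_\chi$, be a group homomorphism, given by line bundles $L_\chi$ and isomorphisms $L_\chi \otimes L_{\chi'} \cong L_{\chi+\chi'}$. Let $p \colon P \to X$ be the toric bundle: for $f \colon X' \to X$, the $X'$-valued points $s$ of $P$ over $X$ are the families of trivializations $\langle \chi, s\rangle$ of $f^\ast L_\chi$ ($\chi \in \Lambda$) such that $\langle \chi, s\rangle \otimes \langle \chi', s\rangle = \langle \chi+\chi', s\rangle$. The split torus $T$ over $S$ with group of characters $\Lambda$ acts on $P$ by $\langle \chi, ts\rangle = \chi(t)\langle \chi, s\rangle$. Let $u \colon S \to P$ be a morphism over $S$ and $x = p \circ u$; assume that $u$, $x$ and the neutral sections $e$ of $T$ and $1$ of $\mathbb{G}_{m,S}$ are closed immersions (this is automatic when $X$ is separated over $S$). Let $j \colon P_1 \to P$ and $i \colon X_1 \to X$ be the first-order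 thickenings of $P$ along $u$ and of $X$ along $x$, and let $p_1 \colon P_1 \to X_1$ be the morphism induced by $p$. Modules on $P_1$ and $X_1$ are identified with their push-forwards to $S$. For a section $v$ of an $S$-analytic space $Y$, $v^\ast\Omega^1_{Y/S}$ is identified with the augmentation ideal of the first-order thickening of $Y$ along $v$; put $\omega_T = e^\ast \Omega^1_{T/S}$. Fix $\chi \in \Lambda$. Then there is a unique homomorphism of $\mathcal{O}_S$-modules \[ q \colon j^\ast p^\ast L_\chi \longrightarrow \omega_T \otimes x^\ast L_\chi \] that vanishes on the image of $i^\ast L_\chi$ under pull-back along $p_1$ and whose restriction to the submodule $u^\ast\Omega^1_{P/S} \otimes x^\ast L_\chi$ of $j^\ast p^\ast L_\chi$ is $\alpha \otimes \mathrm{id}$, where $\alpha \colon u^\ast \Omega^1_{P/S} \to u^\ast \Omega^1_{P/X} \cong \omega_T$ is the pull-back of differential forms along the orbit map $T \to P$, $t \mapsto tu$. (That is, $q$ is the projection $j^\ast p^\ast L_\chi \to j^\ast p^\ast L_\chi / i^\ast L_\chi \cong u^\ast\Omega^1_{P/X} \otimes x^\ast L_\chi \cong \omega_T \otimes x^\ast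 L_\chi$, the last isomorphism being induced by the action of $T$ on $P$.) Moreover, \[ q(\langle \chi, j\rangle) = \chi^\ast \tfrac{\mathrm{d}z}{z} \otimes \langle \chi, u\rangle , \] where $z$ is the coordinate function on $\mathbb{G}_{m,S}$, $\chi$ is seen as a character $T \to \mathbb{G}_{m,S}$, and $\langle \chi, u \rangle$ is the trivialization of $x^\ast L_\chi$ given by $u$. -/

import Mathlib

open Topology Filter CategoryTheory

universe u v

namespace Berkovich

noncomputable section

/-! ### Affinoid algebras, their spectra, and affinoid domains -/

section Affinoid

/-- A family of coefficients `c` for which `‖c ν‖ r ^ ν` tends to zero, that is, an element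
`∑ c ν T ^ ν` of the algebra `K{r⁻¹T}` of power series converging on the closed polydisc of
polyradius `r`. -/
def IsConvergent {K : Type u} [NormedField K] {n : ℕ} (r : Fin n → ℝ)
    (c : (Fin n →₀ ℕ) → K) : Prop :=
  Tendsto (fun ν => ‖c ν‖ * ν.prod (fun i k => r i ^ k)) cofinite (𝓝 0)

/-- The topological `K`-algebra `A` is `K`-affinoid: it is Hausdorff and, for some polyradius `r`,
there is an admissible (that is, continuous, surjective and open) homomorphism of `K`-algebras
`K{r⁻¹T} → A`, `∑ c ν T ^ ν ↦ ∑ c ν a ^ ν`. A bounded homomorphism of affinoid algebras is the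
same as a continuous one; therefore only the topology of `A` is retained. -/
structure IsAffinoidAlgebra (K : Type u) [NormedField K] (A : Type u) [CommRing A]
    [TopologicalSpace A] [Algebra K A] : Prop where
  isTopologicalRing : IsTopologicalRing A
  t2 : T2Space A
  presentation : ∃ (n : ℕ) (r : Fin n → ℝ) (a : Fin n → A), (∀ i, 0 < r i) ∧
    (∀ c : (Fin n →₀ ℕ) → K, IsConvergent r c →
      Summable (fun ν => c ν • ν.prod (fun i k => a i ^ k))) ∧
    (∀ b : A, ∃ c : (Fin n →₀ ℕ) → K, IsConvergent r c ∧
      HasSum (fun ν => c ν • ν.prod (fun i k => a i ^ k)) b) ∧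
    (𝓝 (0 : A)).HasBasis (fun ε : ℝ => 0 < ε) (fun ε => {b | ∃ c : (Fin n →₀ ℕ) → K,
      IsConvergent r c ∧ (∀ ν, ‖c ν‖ * ν.prod (fun i k => r i ^ k) < ε) ∧
      HasSum (fun ν => c ν • ν.prod (fun i k => a i ^ k)) b})

/-- The Berkovich spectrum `M(A)` of a topological `K`-algebra: continuous multiplicative
seminorms on `A` that extend the absolute value of `K`. (For a Banach algebra `A` over a
non-trivially valued field these are the bounded multiplicative seminorms.) -/
def Spectrum (K : Type u) [NormedField K] (A : Type u) [CommRing A] [TopologicalSpace A]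
    [Algebra K A] : Type u :=
  {p : MulRingSeminorm A // Continuous p ∧ ∀ k : K, p (algebraMap K A k) = ‖k‖}

/-- The topology of pointwise convergence on the spectrum. -/
instance (K : Type u) [NormedField K] (A : Type u) [CommRing A] [TopologicalSpace A]
    [Algebra K A] : TopologicalSpace (Spectrum K A) :=
  TopologicalSpace.induced (fun (p : Spectrum K A) (a : A) => p.1 a) inferInstance

/-- `ψ : A → C` identifies `M(C)` with the affinoid domain `W` of `M(A)`: the set `W` is closed,
`M(C) → M(A)` has values in `W`, and `ψ` is universal among the bounded homomorphisms from `A` to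
an `L`-affinoid algebra `B`, with `L` any complete valued extension of `K`, for which
`M(B) → M(A)` has values in `W`. -/
def IsAffinoidDomain {K : Type u} [NormedField K] {A C : Type u}
    [CommRing A] [TopologicalSpace A] [Algebra K A]
    [CommRing C] [TopologicalSpace C] [Algebra K C]
    (ψ : A →A[K] C) (W : Set (Spectrum K A)) : Prop :=
  IsClosed W ∧ (∀ p : Spectrum K C, ∃ w ∈ W, ∀ a, w.1 a = p.1 (ψ a)) ∧
  ∀ (L : Type u) [NontriviallyNormedField L] [IsUltrametricDist L] [CompleteSpace L]
    [NormedAlgebra K L] (B : Type u) [CommRing B] [TopologicalSpace B] [Algebra K B]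
    [Algebra L B] [IsScalarTower K L B], IsAffinoidAlgebra L B →
    ∀ φ : A →A[K] B, (∀ p : Spectrum L B, ∃ w ∈ W, ∀ a, w.1 a = p.1 (φ a)) →
      ∃! θ : C →A[K] B, θ.comp ψ = φ

end Affinoid

/-! ### The G-topology -/

/-- The members of `τ` contained in `Y` form a quasi-net on `Y`. -/
def IsQuasiNet {X : Type u} [TopologicalSpace X] (τ : Set (Set X)) (Y : Set X) : Prop :=
  ∀ y ∈ Y, ∃ F : Set (Set X), F.Finite ∧ F ⊆ τ ∧ (∀ U ∈ F, y ∈ U ∧ U ⊆ Y) ∧ ⋃₀ F ∈ 𝓝[Y] y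

/-- A locally Hausdorff topological space endowed with a net of subsets. -/
structure NetSpace where
  carrier : Type u
  [top : TopologicalSpace carrier]
  locallyHausdorff : ∀ x : carrier, ∃ U : Set carrier, IsOpen U ∧ x ∈ U ∧ T2Space U
  /-- The net; below, its members are affinoid domains. -/
  aff : Set (Set carrier)
  cover : IsQuasiNet aff Set.univ
  net : ∀ U ∈ aff, ∀ V ∈ aff, IsQuasiNet aff (U ∩ V)

attribute [instance] NetSpace.top

/-- The analytic domains of `X`: the open sets of its G-topology. -/
structure NetSpace.Dom (X : NetSpace.{u}) : Type u where
  carrier : Set X.carrier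
  isDom : IsQuasiNet X.aff carrier

namespace NetSpace

variable {X : NetSpace.{u}}

theorem isQuasiNet_of_mem {U : Set X.carrier} (hU : U ∈ X.aff) : IsQuasiNet X.aff U := by
  intro y hy
  refine ⟨{U}, Set.finite_singleton _, by simpa using hU, ?_, ?_⟩
  · rintro V rfl
    exact ⟨hy, subset_rfl⟩
  · simpa using self_mem_nhdsWithin

theorem isQuasiNet_inter {Y Z : Set X.carrier} (hY : IsQuasiNet X.aff Y)
    (hZ : IsQuasiNet X.aff Z) : IsQuasiNet X.aff (Y ∩ Z) := by
  rintro y ⟨hy, hz⟩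
  obtain ⟨F, hF, hFa, hFy, hFn⟩ := hY y hy
  obtain ⟨G, hG, hGa, hGy, hGn⟩ := hZ y hz
  have key : ∀ q : Set X.carrier × Set X.carrier, q ∈ F ×ˢ G → ∃ H : Set (Set X.carrier),
      H.Finite ∧ H ⊆ X.aff ∧ (∀ U ∈ H, y ∈ U ∧ U ⊆ q.1 ∩ q.2) ∧ ⋃₀ H ∈ 𝓝[q.1 ∩ q.2] y :=
    fun q hq => X.net q.1 (hFa hq.1) q.2 (hGa hq.2) y ⟨(hFy _ hq.1).1, (hGy _ hq.2).1⟩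
  choose! H hH hHa hHy hHn using key
  refine ⟨⋃ q ∈ F ×ˢ G, H q, (hF.prod hG).biUnion hH, Set.iUnion₂_subset hHa, ?_, ?_⟩
  · intro U hU
    obtain ⟨q, hq, hUq⟩ := Set.mem_iUnion₂.1 hU
    refine ⟨(hHy q hq U hUq).1, ((hHy q hq U hUq).2).trans ?_⟩
    exact Set.inter_subset_inter (hFy _ hq.1).2 (hGy _ hq.2).2
  · have h1 : (⋃ q ∈ F ×ˢ G, q.1 ∩ q.2) ∈ 𝓝[Y ∩ Z] y := by
      have hF' : ⋃₀ F ∈ 𝓝[Y ∩ Z] y := nhdsWithin_mono y Set.inter_subset_left hFn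
      have hG' : ⋃₀ G ∈ 𝓝[Y ∩ Z] y := nhdsWithin_mono y Set.inter_subset_right hGn
      filter_upwards [hF', hG'] with w hw hw'
      obtain ⟨U, hU, hwU⟩ := hw
      obtain ⟨V, hV, hwV⟩ := hw'
      exact Set.mem_iUnion₂.2 ⟨(U, V), ⟨hU, hV⟩, hwU, hwV⟩
    refine nhdsWithin_le_of_mem h1 ?_
    rw [nhdsWithin_biUnion (hF.prod hG)]
    simp only [mem_iSup]
    intro q hq
    exact mem_of_superset (hHn q hq)
      (Set.sUnion_subset_sUnion (Set.subset_biUnion_of_mem (u := H) hq))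

instance : PartialOrder X.Dom := PartialOrder.lift Dom.carrier fun Y Z h => by
  cases Y; cases Z; cases h; rfl

instance : Min X.Dom := ⟨fun Y Z => ⟨Y.1 ∩ Z.1, isQuasiNet_inter Y.2 Z.2⟩⟩

instance : SemilatticeInf X.Dom where
  inf := min
  inf_le_left Y Z := (Set.inter_subset_left : Y.1 ∩ Z.1 ⊆ Y.1)
  inf_le_right Y Z := (Set.inter_subset_right : Y.1 ∩ Z.1 ⊆ Z.1)
  le_inf Y Z W h h' := (Set.subset_inter h h' : Y.1 ⊆ Z.1 ∩ W.1)

instance : OrderTop X.Dom where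
  top := ⟨Set.univ, X.cover⟩
  le_top Y := Set.subset_univ Y.1

/-- A set that has the quasi-net property, as an analytic domain. -/
def dom (X : NetSpace.{u}) (Y : Set X.carrier) (h : IsQuasiNet X.aff Y) : X.Dom := ⟨Y, h⟩

theorem dom_le {Y Z : Set X.carrier} {hY : IsQuasiNet X.aff Y} {hZ : IsQuasiNet X.aff Z}
    (h : Y ⊆ Z) : X.dom Y hY ≤ X.dom Z hZ := h

/-- The coverings of the G-topology: a family of analytic domains contained in `Y` that forms
a quasi-net on `Y`. -/
def IsGCover {ι : Type u} (Z : ι → X.Dom) (Y : X.Dom) : Prop :=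
  (∀ i, Z i ≤ Y) ∧ IsQuasiNet (Set.range fun i => (Z i).1) Y.1

end NetSpace

/-! ### Analytic spaces -/

/-- The underlying space of a `K`-analytic space with its G-topology, a sheaf of topological
`K`-algebras on it, and, for each point, a multiplicative seminorm `|f(x)|` on the sections `f`
over the analytic domains containing it. -/
structure ValuedGSpace (K : Type u) [NontriviallyNormedField K] extends NetSpace.{u} where
  sec : toNetSpace.Dom → Type u
  [commRing : ∀ Y, CommRing (sec Y)]
  [topSec : ∀ Y, TopologicalSpace (sec Y)]
  [algebra : ∀ Y, Algebra K (sec Y)]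
  res : ∀ {Y Z : toNetSpace.Dom}, Z ≤ Y → (sec Y →A[K] sec Z)
  res_id : ∀ (Y : toNetSpace.Dom) (s : sec Y), res le_rfl s = s
  res_res : ∀ {Y Z W : toNetSpace.Dom} (h : Z ≤ Y) (h' : W ≤ Z) (s : sec Y),
    res h' (res h s) = res (h'.trans h) s
  glue : ∀ {ι : Type u} (Z : ι → toNetSpace.Dom) (Y : toNetSpace.Dom)
    (hZ : NetSpace.IsGCover Z Y) (s : ∀ i, sec (Z i)),
    (∀ i j, res (inf_le_left : Z i ⊓ Z j ≤ Z i) (s i) =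
      res (inf_le_right : Z i ⊓ Z j ≤ Z j) (s j)) →
    ∃! t : sec Y, ∀ i, res (hZ.1 i) t = s i
  /-- Sections over `Y` carry the projective limit topology over the members of `aff` in `Y`. -/
  isInducing : ∀ Y : toNetSpace.Dom, IsInducing
    (fun (s : sec Y) (U : {U : toNetSpace.Dom // U.1 ∈ aff ∧ U ≤ Y}) => res U.2.2 s)
  val : ∀ Y : toNetSpace.Dom, Y.1 → Spectrum K (sec Y)
  val_res : ∀ {Y Z : toNetSpace.Dom} (h : Z ≤ Y) (x : Z.1) (s : sec Y),
    (val Z x).1 (res h s) = (val Y ⟨x.1, h x.2⟩).1 s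

attribute [instance] ValuedGSpace.commRing ValuedGSpace.topSec ValuedGSpace.algebra

/-- The analytic domain `U` is an affinoid domain: `O(U)` is affinoid, evaluation of functions is
a homeomorphism `U → M(O(U))`, and the members of the given net contained in `U` correspond to
affinoid domains of `M(O(U))`, with the right algebra of functions. -/
def ValuedGSpace.IsAffinoid {K : Type u} [NontriviallyNormedField K] (X : ValuedGSpace K)
    (U : X.Dom) : Prop :=
  IsAffinoidAlgebra K (X.sec U) ∧ IsHomeomorph (X.val U) ∧
  ∀ (W : X.Dom) (h : W ≤ U), W.1 ∈ X.aff →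
    IsAffinoidDomain (X.res h) (X.val U '' {x | x.1 ∈ W.1})

/-- A `K`-analytic space in the sense of Berkovich, presented as a space with a G-topology and a
structure sheaf on it. The members of the net are affinoid, and the net contains all affinoid
domains of each of its members (any `K`-analytic space has an atlas with this property). -/
structure AnalyticSpace (K : Type u) [NontriviallyNormedField K] extends ValuedGSpace K where
  affinoid : ∀ U : toNetSpace.Dom, U.1 ∈ aff → toValuedGSpace.IsAffinoid U
  saturated : ∀ U : toNetSpace.Dom, U.1 ∈ aff → ∀ W ⊆ U.1,
    (∃ (C : Type u) (_ : CommRing C) (_ : TopologicalSpace C) (_ : Algebra K C)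
      (_ : IsAffinoidAlgebra K C) (ψ : sec U →A[K] C),
      IsAffinoidDomain ψ (val U '' {x | x.1 ∈ W})) → W ∈ aff

variable {K : Type u} [NontriviallyNormedField K]

/-- Morphisms of `K`-analytic spaces: continuous maps that are continuous for the G-topologies,
together with a continuous homomorphism of the structure sheaves compatible with the evaluation
of functions at points. -/
@[ext]
structure Mor (X Y : AnalyticSpace K) where
  base : X.carrier → Y.carrier
  continuous : Continuous base
  isDom : ∀ V : Y.Dom, IsQuasiNet X.aff (base ⁻¹' V.1)
  app : ∀ V : Y.Dom, Y.sec V →A[K] X.sec (X.dom (base ⁻¹' V.1) (isDom V))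
  app_res : ∀ {V W : Y.Dom} (h : W ≤ V) (s : Y.sec V),
    app W (Y.res h s) = X.res (NetSpace.dom_le (Set.preimage_mono h)) (app V s)
  val_app : ∀ (V : Y.Dom) (x : base ⁻¹' V.1) (s : Y.sec V),
    (X.val (X.dom (base ⁻¹' V.1) (isDom V)) x).1 (app V s) = (Y.val V ⟨base x.1, x.2⟩).1 s

/-- The category of `K`-analytic spaces. -/
instance : Category (AnalyticSpace K) where
  Hom X Y := Mor X Y
  id X :=
    { base := id
      continuous := continuous_id
      isDom := fun V => V.2
      app := fun V => ContinuousAlgHom.id K (X.sec V)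
      app_res := fun _ _ => rfl
      val_app := fun _ _ _ => rfl }
  comp {X Y Z} f g :=
    { base := g.base ∘ f.base
      continuous := g.continuous.comp f.continuous
      isDom := fun V => f.isDom (Y.dom (g.base ⁻¹' V.1) (g.isDom V))
      app := fun V => (f.app (Y.dom (g.base ⁻¹' V.1) (g.isDom V))).comp (g.app V)
      app_res := fun {V W} h s => by
        refine (congrArg (f.app _) (g.app_res h s)).trans ?_
        exact f.app_res (NetSpace.dom_le (Set.preimage_mono h)) (g.app V s)
      val_app := fun V x s => by
        refine (f.val_app (Y.dom (g.base ⁻¹' V.1) (g.isDom V)) x (g.app V s)).trans ?_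
        exact g.val_app V ⟨f.base x.1, x.2⟩ s }

/-- The preimage of an analytic domain. -/
def Mor.pre {X Y : AnalyticSpace K} (f : X ⟶ Y) (V : Y.Dom) : X.Dom :=
  X.dom (Mor.base f ⁻¹' V.1) (Mor.isDom f V)

theorem Mor.pre_mono {X Y : AnalyticSpace K} (f : X ⟶ Y) {V W : Y.Dom} (h : W ≤ V) :
    Mor.pre f W ≤ Mor.pre f V := Set.preimage_mono h

/-- The pull-back of functions `O_Y(V) → O_X(f⁻¹(V))`. -/
def Mor.pull {X Y : AnalyticSpace K} (f : X ⟶ Y) (V : Y.Dom) : Y.sec V →A[K] X.sec (Mor.pre f V) :=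
  Mor.app f V

theorem Mor.pull_res {X Y : AnalyticSpace K} (f : X ⟶ Y) {V W : Y.Dom} (h : W ≤ V)
    (s : Y.sec V) : Mor.pull f W (Y.res h s) = X.res (Mor.pre_mono f h) (Mor.pull f V s) :=
  Mor.app_res f h s

/-- The pull-back of functions, followed by restriction to a smaller domain. -/
def Mor.pullRes {X Y : AnalyticSpace K} (f : X ⟶ Y) (V : Y.Dom) (W : X.Dom)
    (h : W ≤ Mor.pre f V) : Y.sec V →+* X.sec W :=
  ((X.res h).comp (Mor.pull f V) : Y.sec V →A[K] X.sec W)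

/-- The pull-back of global functions. -/
def Mor.pullTop {X Y : AnalyticSpace K} (f : X ⟶ Y) : Y.sec ⊤ →+* X.sec ⊤ :=
  Mor.pullRes f ⊤ ⊤ (fun _ _ => trivial)

theorem Mor.pullRes_res {X Y : AnalyticSpace K} (f : X ⟶ Y) {V V' : Y.Dom} {W W' : X.Dom}
    (h : W ≤ Mor.pre f V) (h' : W' ≤ Mor.pre f V') (hV : V' ≤ V) (hW : W' ≤ W) (s : Y.sec V) :
    Mor.pullRes f V' W' h' (Y.res hV s) = X.res hW (Mor.pullRes f V W h s) := by
  change X.res _ (Mor.pull f V' (Y.res hV s)) = X.res _ (X.res _ (Mor.pull f V s))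
  rw [Mor.pull_res, X.res_res, X.res_res]

theorem Mor.res_pullRes {X Y : AnalyticSpace K} (f : X ⟶ Y) {V : Y.Dom} {W W' : X.Dom}
    (h : W ≤ Mor.pre f V) (hW : W' ≤ W) (s : Y.sec V) :
    X.res hW (Mor.pullRes f V W h s) = Mor.pullRes f V W' (hW.trans h) s :=
  X.res_res _ _ _

theorem Mor.pullRes_comp {X Y Z : AnalyticSpace K} (f : X ⟶ Y) (g : Y ⟶ Z) (k : X ⟶ Z)
    (hk : f ≫ g = k) {U : Z.Dom} {V : Y.Dom} {W : X.Dom} (h : V ≤ Mor.pre g U)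
    (h' : W ≤ Mor.pre f V) (h'' : W ≤ Mor.pre k U) (s : Z.sec U) :
    Mor.pullRes f V W h' (Mor.pullRes g U V h s) = Mor.pullRes k U W h'' s := by
  subst hk
  refine (Mor.pullRes_res f (V := Mor.pre g U) (W := W) (h'.trans (Mor.pre_mono f h)) h' h le_rfl
    (Mor.pull g U s)).trans ?_
  exact X.res_id _ _

theorem Mor.le_pre_comp {X Y Z : AnalyticSpace K} {f : X ⟶ Y} {g : Y ⟶ Z} {k : X ⟶ Z}
    (hk : f ≫ g = k) (U : Z.Dom) : Mor.pre k U ≤ Mor.pre f (Mor.pre g U) := by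
  subst hk
  exact le_rfl

/-- `φ` is a closed immersion: over each affinoid domain `V` of the net of `Y`, it is given by an
admissible epimorphism of affinoid algebras. -/
def IsClosedImmersion {X Y : AnalyticSpace K} (φ : X ⟶ Y) : Prop :=
  ∀ V : Y.Dom, V.1 ∈ Y.aff → X.IsAffinoid (Mor.pre φ V) ∧ IsOpenQuotientMap (Mor.pull φ V)

/-! ### Modules, line bundles and their pull-backs -/

/-- A presheaf of `O_X`-modules for the G-topology. -/
structure PreMod (X : AnalyticSpace K) where
  sec : X.Dom → Type u
  [addCommGroup : ∀ V, AddCommGroup (sec V)]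
  [module : ∀ V, Module (X.sec V) (sec V)]
  res : ∀ {V W : X.Dom}, W ≤ V → (sec V →+ sec W)
  res_smul : ∀ {V W : X.Dom} (h : W ≤ V) (a : X.sec V) (m : sec V),
    res h (a • m) = X.res h a • res h m
  res_id : ∀ (V : X.Dom) (m : sec V), res le_rfl m = m
  res_res : ∀ {V W Z : X.Dom} (h : W ≤ V) (h' : Z ≤ W) (m : sec V),
    res h' (res h m) = res (h'.trans h) m

attribute [instance] PreMod.addCommGroup PreMod.module

/-- Homomorphisms of `O_X`-modules. -/
@[ext]
structure PreMod.Hom {X : AnalyticSpace K} (M N : PreMod X) where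
  map : ∀ V : X.Dom, M.sec V →ₗ[X.sec V] N.sec V
  map_res : ∀ {V W : X.Dom} (h : W ≤ V) (m : M.sec V), map W (M.res h m) = N.res h (map V m)

/-- The structure sheaf. -/
def PreMod.structureSheaf (X : AnalyticSpace K) : PreMod X where
  sec := X.sec
  res h := (X.res h : _ →A[K] _)
  res_smul h a m := map_mul (X.res h) a m
  res_id := X.res_id
  res_res h h' m := X.res_res h h' m

/-- The push-forward of a module. -/
def PreMod.pushforward {X Y : AnalyticSpace K} (f : X ⟶ Y) (M : PreMod X) : PreMod Y where
  sec V := M.sec (Mor.pre f V)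
  module V := Module.compHom (M.sec (Mor.pre f V))
    ((Mor.pull f V : Y.sec V →A[K] X.sec (Mor.pre f V)) : Y.sec V →+* X.sec (Mor.pre f V))
  res h := M.res (Mor.pre_mono f h)
  res_smul {V W} h a m := by
    refine (M.res_smul (V := Mor.pre f V) (W := Mor.pre f W) (Mor.pre_mono f h)
      (Mor.pull f V a) m).trans ?_
    rw [← Mor.pull_res]
    rfl
  res_id V m := M.res_id _ m
  res_res h h' m := M.res_res _ _ m

/-- The section `ℓ` over `U` is a frame: `a ↦ a ℓ` is an isomorphism from `O_X` to the given module
on `U`. -/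
def PreMod.IsFrame {X : AnalyticSpace K} (M : PreMod X) {U : X.Dom} (ℓ : M.sec U) : Prop :=
  ∀ (W : X.Dom) (h : W ≤ U), Function.Bijective fun a : X.sec W => a • M.res h ℓ

/-- The frames of a module over the analytic domain `U`. -/
def PreMod.Frame {X : AnalyticSpace K} (M : PreMod X) (U : X.Dom) : Type u :=
  {ℓ : M.sec U // M.IsFrame ℓ}

/-- The restriction of a frame. -/
def PreMod.Frame.res {X : AnalyticSpace K} {M : PreMod X} {U W : X.Dom} (h : W ≤ U)
    (ℓ : M.Frame U) : M.Frame W :=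
  ⟨M.res h ℓ.1, fun Z h' => by simpa only [M.res_res] using ℓ.2 Z (h'.trans h)⟩

/-- A line bundle: a sheaf of `O_X`-modules for the G-topology that locally has a frame. -/
structure LineBundle (X : AnalyticSpace K) extends PreMod X where
  glue : ∀ {ι : Type u} (Z : ι → X.Dom) (Y : X.Dom)
    (hZ : NetSpace.IsGCover Z Y) (s : ∀ i, sec (Z i)),
    (∀ i j, res (inf_le_left : Z i ⊓ Z j ≤ Z i) (s i) =
      res (inf_le_right : Z i ⊓ Z j ≤ Z j) (s j)) →
    ∃! t : sec Y, ∀ i, res (hZ.1 i) t = s i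
  locallyFree : IsQuasiNet {U | ∃ V : X.Dom, V.1 = U ∧ Nonempty (toPreMod.Frame V)} Set.univ

/-- The sections over `V` of `M ⊗ f^*L`, for a morphism `f : X' → X`, a line bundle `L` on `X` and a
sheaf of modules `M` on `X'`, given through their coordinates: such a section `s` is the same
as a rule which to each frame `ℓ` of `L` over an analytic domain `U` of `X` attaches the section `m`
of `M` over `V ∩ f⁻¹(U)` such that `s = m ⊗ f^*ℓ` there. These are compatible with restriction,
and `m ⊗ f^*ℓ = m' ⊗ f^*(aℓ)` if and only if `m = f^*(a) m'`. -/
structure IsTwistSec {X' X : AnalyticSpace K} (M : PreMod X') (f : X' ⟶ X) (L : LineBundle X)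
    (V : X'.Dom) (s : ∀ (U : X.Dom), L.Frame U → M.sec (V ⊓ Mor.pre f U)) : Prop where
  res : ∀ (U W : X.Dom) (h : W ≤ U) (ℓ : L.Frame U),
    s W (ℓ.res h) = M.res (inf_le_inf_left V (Mor.pre_mono f h)) (s U ℓ)
  smul : ∀ (U : X.Dom) (ℓ ℓ' : L.Frame U) (a : X.sec U), ℓ'.1 = a • ℓ.1 →
    s U ℓ = Mor.pullRes f U (V ⊓ Mor.pre f U) inf_le_right a • s U ℓ'

/-- The group of sections over `V` of `M ⊗ f^*L`. -/
def twistSec {X' X : AnalyticSpace K} (M : PreMod X') (f : X' ⟶ X) (L : LineBundle X)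
    (V : X'.Dom) : AddSubgroup (∀ (U : X.Dom), L.Frame U → M.sec (V ⊓ Mor.pre f U)) where
  carrier := {s | IsTwistSec M f L V s}
  add_mem' hs ht :=
    { res := fun U W h ℓ =>
        (congrArg₂ (· + ·) (hs.res U W h ℓ) (ht.res U W h ℓ)).trans (map_add _ _ _).symm
      smul := fun U ℓ ℓ' a ha =>
        (congrArg₂ (· + ·) (hs.smul U ℓ ℓ' a ha) (ht.smul U ℓ ℓ' a ha)).trans
          (smul_add _ _ _).symm }
  zero_mem' :=
    { res := fun _ _ _ _ => (map_zero _).symm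
      smul := fun _ _ _ _ _ => (smul_zero _).symm }
  neg_mem' hs :=
    { res := fun U W h ℓ => (congrArg (- ·) (hs.res U W h ℓ)).trans (map_neg _ _).symm
      smul := fun U ℓ ℓ' a ha =>
        (congrArg (- ·) (hs.smul U ℓ ℓ' a ha)).trans (smul_neg _ _).symm }

instance {X' X : AnalyticSpace K} (M : PreMod X') (f : X' ⟶ X) (L : LineBundle X) (V : X'.Dom) :
    Module (X'.sec V) (twistSec M f L V) where
  smul a s := ⟨fun U ℓ => X'.res inf_le_left a • s.1 U ℓ,
    { res := fun U W h ℓ => by rw [s.2.res U W h ℓ, M.res_smul, X'.res_res]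
      smul := fun U ℓ ℓ' b hb => by rw [s.2.smul U ℓ ℓ' b hb, smul_smul, smul_smul, mul_comm] }⟩
  one_smul s := Subtype.ext <| funext fun U => funext fun ℓ => by
    change X'.res inf_le_left 1 • s.1 U ℓ = s.1 U ℓ
    rw [map_one, one_smul]
  mul_smul a b s := Subtype.ext <| funext fun U => funext fun ℓ => by
    change X'.res inf_le_left (a * b) • s.1 U ℓ =
      X'.res inf_le_left a • X'.res inf_le_left b • s.1 U ℓ
    rw [map_mul, mul_smul]
  smul_zero a := Subtype.ext <| funext fun U => funext fun ℓ => smul_zero _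
  smul_add a s t := Subtype.ext <| funext fun U => funext fun ℓ => smul_add _ _ _
  add_smul a b s := Subtype.ext <| funext fun U => funext fun ℓ => by
    have h : V ⊓ Mor.pre f U ≤ V := inf_le_left
    change X'.res h (a + b) • s.1 U ℓ = X'.res h a • s.1 U ℓ + X'.res h b • s.1 U ℓ
    rw [map_add, add_smul]
  zero_smul s := Subtype.ext <| funext fun U => funext fun ℓ => by
    change X'.res inf_le_left 0 • s.1 U ℓ = 0
    rw [map_zero, zero_smul]

/-- The module `M ⊗ f^*L` on `X'`. -/
def twist {X' X : AnalyticSpace K} (M : PreMod X') (f : X' ⟶ X) (L : LineBundle X) :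
    PreMod X' where
  sec V := twistSec M f L V
  res {V W} h :=
    { toFun := fun s => ⟨fun U ℓ => M.res (inf_le_inf_right _ h) (s.1 U ℓ),
        { res := fun U Z hZ ℓ => by rw [s.2.res U Z hZ ℓ, M.res_res, M.res_res]
          smul := fun U ℓ ℓ' a ha => by
            rw [s.2.smul U ℓ ℓ' a ha, M.res_smul, Mor.res_pullRes] }⟩
      map_zero' := Subtype.ext <| funext fun U => funext fun ℓ => map_zero _
      map_add' := fun s t => Subtype.ext <| funext fun U => funext fun ℓ => map_add _ _ _ }
  res_smul {V W} h a s := Subtype.ext <| funext fun U => funext fun ℓ => by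
    refine (M.res_smul (inf_le_inf_right _ h) (X'.res inf_le_left a) (s.1 U ℓ)).trans ?_
    refine congrArg (· • M.res (inf_le_inf_right _ h) (s.1 U ℓ)) ?_
    exact (X'.res_res _ _ _).trans (X'.res_res _ _ _).symm
  res_id V s := Subtype.ext <| funext fun U => funext fun ℓ => M.res_id _ _
  res_res h h' s := Subtype.ext <| funext fun U => funext fun ℓ => M.res_res _ _ _

/-- The pull-back `f^*L` of a line bundle. -/
def pullback {X' X : AnalyticSpace K} (f : X' ⟶ X) (L : LineBundle X) : PreMod X' :=
  twist (PreMod.structureSheaf X') f L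

/-- The coordinate, a function, of a section of `f^*L` with respect to a frame of `L`. -/
def pullback.coord {X' X : AnalyticSpace K} {f : X' ⟶ X} {L : LineBundle X} {V : X'.Dom}
    (s : (pullback f L).sec V) {U : X.Dom} (ℓ : L.Frame U) : X'.sec (V ⊓ Mor.pre f U) :=
  (show twistSec (PreMod.structureSheaf X') f L V from s).1 U ℓ

/-- For `g : X'' → X'` and `f : X' → X` with composite `k`, the pull-back along `g` of sections of
`f^*L` over `V` to sections of `g^*f^*L = k^*L` over an analytic domain `W` contained
in `g⁻¹(V)`. -/
def pullSec {X'' X' X : AnalyticSpace K} (g : X'' ⟶ X') (f : X' ⟶ X) (k : X'' ⟶ X)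
    (hk : g ≫ f = k) (L : LineBundle X) {V : X'.Dom} {W : X''.Dom} (hW : W ≤ Mor.pre g V)
    (s : (pullback f L).sec V) : (pullback k L).sec W :=
  have key : ∀ U : X.Dom, W ⊓ Mor.pre k U ≤ Mor.pre g (V ⊓ Mor.pre f U) := fun U =>
    (inf_le_inf hW (Mor.le_pre_comp hk U) : W ⊓ Mor.pre k U ≤
      Mor.pre g V ⊓ Mor.pre g (Mor.pre f U))
  ⟨fun U ℓ => Mor.pullRes g (V ⊓ Mor.pre f U) (W ⊓ Mor.pre k U) (key U) (pullback.coord s ℓ),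
    { res := fun U Z h ℓ =>
        (congrArg (Mor.pullRes g (V ⊓ Mor.pre f Z) (W ⊓ Mor.pre k Z) (key Z))
          (s.2.res U Z h ℓ)).trans
          (Mor.pullRes_res g (key U) (key Z) (inf_le_inf_left V (Mor.pre_mono f h))
            (inf_le_inf_left W (Mor.pre_mono k h)) _)
      smul := fun U ℓ ℓ' a ha => by
        refine (congrArg (Mor.pullRes g (V ⊓ Mor.pre f U) (W ⊓ Mor.pre k U) (key U))
          (s.2.smul U ℓ ℓ' a ha)).trans ?_
        refine (map_mul (Mor.pullRes g (V ⊓ Mor.pre f U) (W ⊓ Mor.pre k U) (key U)) _ _).trans ?_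
        rw [Mor.pullRes_comp g f k hk inf_le_right (key U) inf_le_right]
        rfl }⟩

/-- The section `m ⊗ s` of `M ⊗ f^*L`. -/
def tmul {X' X : AnalyticSpace K} {M : PreMod X'} {f : X' ⟶ X} {L : LineBundle X}
    {V : X'.Dom} (m : M.sec V) (s : (pullback f L).sec V) : (twist M f L).sec V :=
  ⟨fun U ℓ => pullback.coord s ℓ • M.res inf_le_left m,
    { res := fun U W h ℓ => by
        rw [M.res_smul, M.res_res]
        exact congrArg (· • M.res inf_le_left m) (s.2.res U W h ℓ)
      smul := fun U ℓ ℓ' a ha => by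
        rw [smul_smul]
        exact congrArg (· • M.res inf_le_left m) (s.2.smul U ℓ ℓ' a ha) }⟩

/-! ### Toric bundles -/

/-- A group homomorphism `Λ → Pic(X)`, `χ ↦ L χ`: a line bundle `L χ` for each `χ`, and isomorphisms
`L χ ⊗ L χ' ≅ L (χ + χ')`, that is, bilinear maps that take pairs of frames to frames. -/
structure LineBundleSystem (Λ : Type v) [AddCommGroup Λ] (X : AnalyticSpace K) where
  L : Λ → LineBundle X
  mul : ∀ (χ χ' : Λ) (U : X.Dom),
    (L χ).sec U →ₗ[X.sec U] (L χ').sec U →ₗ[X.sec U] (L (χ + χ')).sec U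
  mul_res : ∀ (χ χ' : Λ) {U W : X.Dom} (h : W ≤ U) (ℓ : (L χ).sec U) (ℓ' : (L χ').sec U),
    mul χ χ' W ((L χ).res h ℓ) ((L χ').res h ℓ') = (L (χ + χ')).res h (mul χ χ' U ℓ ℓ')
  mul_isFrame : ∀ (χ χ' : Λ) (U : X.Dom) (ℓ : (L χ).Frame U) (ℓ' : (L χ').Frame U),
    (L (χ + χ')).IsFrame (mul χ χ' U ℓ.1 ℓ'.1)

section Toric

variable {Λ : Type v} [AddCommGroup Λ] {X : AnalyticSpace K}

/-- Trivializations `⟨χ, s⟩` of the line bundles `f^*(L χ)`, for `χ` in `Λ`, satisfying the relations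
`⟨χ, s⟩ ⊗ ⟨χ', s⟩ = ⟨χ + χ', s⟩`. -/
@[ext]
structure TrivSystem (L : LineBundleSystem Λ X) {X' : AnalyticSpace K} (f : X' ⟶ X) where
  triv : ∀ χ : Λ, (pullback f (L.L χ)).sec ⊤
  isUnit : ∀ (χ : Λ) (U : X.Dom) (ℓ : (L.L χ).Frame U), IsUnit (pullback.coord (triv χ) ℓ)
  mul : ∀ (χ χ' : Λ) (U : X.Dom) (ℓ : (L.L χ).Frame U) (ℓ' : (L.L χ').Frame U),
    pullback.coord (triv (χ + χ')) ⟨L.mul χ χ' U ℓ.1 ℓ'.1, L.mul_isFrame χ χ' U ℓ ℓ'⟩ =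
      pullback.coord (triv χ) ℓ * pullback.coord (triv χ') ℓ'

/-- The pull-back of a system of trivializations. -/
def TrivSystem.pull {L : LineBundleSystem Λ X} {X'' X' : AnalyticSpace K} {f : X' ⟶ X}
    (t : TrivSystem L f) (g : X'' ⟶ X') (k : X'' ⟶ X) (hk : g ≫ f = k) : TrivSystem L k where
  triv χ := pullSec g f k hk (L.L χ) (V := ⊤) (W := ⊤) (fun _ _ => trivial) (t.triv χ)
  isUnit χ U ℓ := (t.isUnit χ U ℓ).map (Mor.pullRes g _ _ _)
  mul χ χ' U ℓ ℓ' := (congrArg (Mor.pullRes g _ _ _) (t.mul χ χ' U ℓ ℓ')).trans (map_mul _ _ _)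

/-- The product `χ ↦ c(χ) ⟨χ, s⟩` of a system of trivializations and a point `c` of the torus. -/
def TrivSystem.smul {L : LineBundleSystem Λ X} {X' : AnalyticSpace K} {f : X' ⟶ X}
    (c : Multiplicative Λ →* (X'.sec ⊤)ˣ) (t : TrivSystem L f) : TrivSystem L f where
  triv χ := (c (Multiplicative.ofAdd χ) : X'.sec ⊤) • t.triv χ
  isUnit χ U ℓ := ((c (Multiplicative.ofAdd χ)).isUnit.map (X'.res inf_le_left)).mul
    (t.isUnit χ U ℓ)
  mul χ χ' U ℓ ℓ' := by
    change X'.res inf_le_left (c (Multiplicative.ofAdd (χ + χ')) : X'.sec ⊤) *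
        pullback.coord (t.triv (χ + χ')) _ =
      X'.res inf_le_left (c (Multiplicative.ofAdd χ) : X'.sec ⊤) *
        pullback.coord (t.triv χ) ℓ *
      (X'.res inf_le_left (c (Multiplicative.ofAdd χ') : X'.sec ⊤) *
        pullback.coord (t.triv χ') ℓ')
    rw [t.mul χ χ' U ℓ ℓ', ofAdd_add, map_mul, Units.val_mul, map_mul]
    ring

/-- The toric bundle: the `X`-analytic space `P` whose points with values in an `X`-analytic space
`f : X' → X` are the systems of trivializations of the line bundles `f^*(L χ)`. -/
structure ToricBundle (L : LineBundleSystem Λ X) where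
  space : AnalyticSpace K
  proj : space ⟶ X
  univ : TrivSystem L proj
  lift : ∀ {X' : AnalyticSpace K} (f : X' ⟶ X), TrivSystem L f → (X' ⟶ space)
  lift_proj : ∀ {X' : AnalyticSpace K} (f : X' ⟶ X) (t : TrivSystem L f), lift f t ≫ proj = f
  pull_lift : ∀ {X' : AnalyticSpace K} (f : X' ⟶ X) (t : TrivSystem L f),
    univ.pull (lift f t) f (lift_proj f t) = t
  lift_pull : ∀ {X' : AnalyticSpace K} (s : X' ⟶ space),
    lift (s ≫ proj) (univ.pull s (s ≫ proj) rfl) = s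

/-- The trivialization `⟨χ, s⟩` of `s^*p^*(L χ)` given by a point `s` of the toric bundle, restricted
to the analytic domain `W`. -/
def ToricBundle.pairing {L : LineBundleSystem Λ X} (P : ToricBundle L) {X' : AnalyticSpace K}
    (χ : Λ) (s : X' ⟶ P.space) (W : X'.Dom) : (pullback (s ≫ P.proj) (L.L χ)).sec W :=
  pullSec s P.proj (s ≫ P.proj) rfl (L.L χ) (V := ⊤) (fun _ _ => trivial) (P.univ.triv χ)

end Toric

/-- The split torus over `S` with group of characters `Λ`: the `S`-analytic space whose points with
values in an `S`-analytic space `S'` are the group homomorphisms from `Λ` to the group of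
invertible functions on `S'`. -/
structure SplitTorus (S : AnalyticSpace K) (Λ : Type v) [AddCommGroup Λ] where
  space : AnalyticSpace K
  proj : space ⟶ S
  char : Multiplicative Λ →* (space.sec ⊤)ˣ
  lift : ∀ {S' : AnalyticSpace K} (_ : S' ⟶ S), (Multiplicative Λ →* (S'.sec ⊤)ˣ) → (S' ⟶ space)
  lift_proj : ∀ {S' : AnalyticSpace K} (f : S' ⟶ S) (c : Multiplicative Λ →* (S'.sec ⊤)ˣ),
    lift f c ≫ proj = f
  pull_lift : ∀ {S' : AnalyticSpace K} (f : S' ⟶ S) (c : Multiplicative Λ →* (S'.sec ⊤)ˣ),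
    (Units.map (Mor.pullTop (lift f c) : _ →* _)).comp char = c
  lift_pull : ∀ {S' : AnalyticSpace K} (t : S' ⟶ space),
    lift (t ≫ proj) ((Units.map (Mor.pullTop t : _ →* _)).comp char) = t

/-- The multiplicative group over `S`: the `S`-analytic space, with coordinate function `z`, whose
points with values in an `S`-analytic space `S'` are the invertible functions on `S'`. -/
structure MultGroup (S : AnalyticSpace K) where
  space : AnalyticSpace K
  proj : space ⟶ S
  z : (space.sec ⊤)ˣ
  lift : ∀ {S' : AnalyticSpace K} (_ : S' ⟶ S), (S'.sec ⊤)ˣ → (S' ⟶ space)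
  lift_proj : ∀ {S' : AnalyticSpace K} (f : S' ⟶ S) (c : (S'.sec ⊤)ˣ), lift f c ≫ proj = f
  pull_lift : ∀ {S' : AnalyticSpace K} (f : S' ⟶ S) (c : (S'.sec ⊤)ˣ),
    Units.map (Mor.pullTop (lift f c) : _ →* _) z = c
  lift_pull : ∀ {S' : AnalyticSpace K} (t : S' ⟶ space),
    lift (t ≫ proj) (Units.map (Mor.pullTop t : _ →* _) z) = t

/-- The neutral section of the multiplicative group. -/
def MultGroup.one {S : AnalyticSpace K} (G : MultGroup S) : S ⟶ G.space := G.lift (𝟙 S) 1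

section Torus

variable {S : AnalyticSpace K} {Λ : Type v} [AddCommGroup Λ]

/-- The neutral section of the torus. -/
def SplitTorus.one (T : SplitTorus S Λ) : S ⟶ T.space := T.lift (𝟙 S) 1

/-- The element `χ` of `Λ` seen as a character of the torus with values in the multiplicative
group. -/
def SplitTorus.character (T : SplitTorus S Λ) (G : MultGroup S) (χ : Λ) : T.space ⟶ G.space :=
  G.lift T.proj (T.char (Multiplicative.ofAdd χ))

/-- The action of the torus on the toric bundle: `⟨χ, t s⟩ = χ(t) ⟨χ, s⟩`. -/
def ToricBundle.act {X : AnalyticSpace K} {L : LineBundleSystem Λ X} (P : ToricBundle L)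
    (T : SplitTorus S Λ) {S' : AnalyticSpace K} (t : S' ⟶ T.space) (s : S' ⟶ P.space) :
    S' ⟶ P.space :=
  P.lift (s ≫ P.proj) ((P.univ.pull s (s ≫ P.proj) rfl).smul
    ((Units.map (Mor.pullTop t : _ →* _)).comp T.char))

/-- The orbit map `T → P`, `t ↦ t u`, of a point `u` of the toric bundle with values in `S`: the
restriction of the isomorphism `T ×_S P → P ×_X P`, `(t, s) ↦ (t s, s)`, to `s = u`. -/
def ToricBundle.orbit {X : AnalyticSpace K} {L : LineBundleSystem Λ X} (P : ToricBundle L)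
    (T : SplitTorus S Λ) (u : S ⟶ P.space) : T.space ⟶ P.space :=
  P.act T (𝟙 T.space) (T.proj ≫ u)

end Torus

/-! ### First-order thickenings -/

/-- The first-order thickening `Y₁` of `Y` along the closed immersion `v : S → Y`: the closed analytic
subspace of `Y` whose ideal is the square of that of `v`. -/
structure Thickening {S Y : AnalyticSpace K} (v : S ⟶ Y) where
  space : AnalyticSpace K
  /-- The closed immersion `Y₁ → Y`. -/
  ι : space ⟶ Y
  /-- The closed immersion `S → Y₁`. -/
  sec : S ⟶ space
  sec_ι : sec ≫ ι = v
  isClosedImmersion : IsClosedImmersion v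
  isClosedImmersion_ι : IsClosedImmersion ι
  ideal : ∀ U : Y.Dom, U.1 ∈ Y.aff →
    RingHom.ker (Mor.pull ι U) = RingHom.ker (Mor.pull v U) ^ 2

/-- The morphism between first-order thickenings induced by a morphism `a : Y → Y'` that maps the
section `v` of `Y` to the section `v'` of `Y'`. -/
structure Thickening.Hom {S Y Y' : AnalyticSpace K} {v : S ⟶ Y} {v' : S ⟶ Y'}
    (N : Thickening v) (N' : Thickening v') (a : Y ⟶ Y') where
  map : N.space ⟶ N'.space
  map_ι : map ≫ N'.ι = N.ι ≫ a
  sec_map : N.sec ≫ map = N'.sec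

section Cotangent

variable {S Y : AnalyticSpace K} {v : S ⟶ Y}

/-- The structural morphism `Y₁ → S`, where `g : Y → S` is the structural morphism of `Y`. -/
def Thickening.proj (N : Thickening v) (g : Y ⟶ S) : N.space ⟶ S := N.ι ≫ g

/-- The `O_S`-module `v^*Ω_{Y/S}`, for a section `v` of `g : Y → S`, as the augmentation ideal of the
first-order thickening of `Y` along `v` (pushed forward to `S`). -/
def Thickening.cotangent (N : Thickening v) (g : Y ⟶ S) : PreMod S where
  sec V := ↥(RingHom.ker (Mor.pull N.sec (Mor.pre (N.proj g) V))).toAddSubgroup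
  module V := Module.compHom (RingHom.ker (Mor.pull N.sec (Mor.pre (N.proj g) V)))
    (Mor.pull (N.proj g) V : S.sec V →+* N.space.sec (Mor.pre (N.proj g) V))
  res {V W} h :=
    { toFun := fun m => ⟨N.space.res (Mor.pre_mono (N.proj g) h) m.1, by
        have hm : Mor.pull N.sec (Mor.pre (N.proj g) V) m.1 = 0 := m.2
        change Mor.pull N.sec (Mor.pre (N.proj g) W) (N.space.res _ m.1) = 0
        rw [Mor.pull_res, hm, map_zero]⟩
      map_zero' := Subtype.ext (map_zero _)
      map_add' := fun m m' => Subtype.ext (map_add _ _ _) }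
  res_smul {V W} h a m := Subtype.ext <| by
    change N.space.res (Mor.pre_mono (N.proj g) h) (Mor.pull (N.proj g) V a * m.1) =
      Mor.pull (N.proj g) W (S.res h a) * N.space.res (Mor.pre_mono (N.proj g) h) m.1
    rw [map_mul, Mor.pull_res]
  res_id V m := Subtype.ext (N.space.res_id _ _)
  res_res h h' m := Subtype.ext (N.space.res_res _ _ _)

/-- A section of `v^*Ω_{Y/S}` over `V` as a function on the inverse image of `V` in the first-order
thickening. -/
def Thickening.toFun (N : Thickening v) (g : Y ⟶ S) {V : S.Dom} (m : (N.cotangent g).sec V) :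
    N.space.sec (Mor.pre (N.proj g) V) :=
  (show ↥(RingHom.ker (Mor.pull N.sec (Mor.pre (N.proj g) V))).toAddSubgroup from m).1

theorem Thickening.pull_toFun (N : Thickening v) (g : Y ⟶ S) {V : S.Dom}
    (m : (N.cotangent g).sec V) : Mor.pull N.sec (Mor.pre (N.proj g) V) (N.toFun g m) = 0 :=
  (show ↥(RingHom.ker (Mor.pull N.sec (Mor.pre (N.proj g) V))).toAddSubgroup from m).2

/-- A function on the first-order thickening that vanishes on `S`, as a section of `v^*Ω_{Y/S}`. -/
def Thickening.ofFun (N : Thickening v) (g : Y ⟶ S) {V : S.Dom}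
    (φ : N.space.sec (Mor.pre (N.proj g) V))
    (h : Mor.pull N.sec (Mor.pre (N.proj g) V) φ = 0) : (N.cotangent g).sec V :=
  show ↥(RingHom.ker (Mor.pull N.sec (Mor.pre (N.proj g) V))).toAddSubgroup from ⟨φ, h⟩

/-- The section `v^*(dφ)` of `v^*Ω_{Y/S}`, for a function `φ` on `Y`: the class of `φ - φ(v)`. -/
def Thickening.d (N : Thickening v) (g : Y ⟶ S) (hg : v ≫ g = 𝟙 S) (φ : Y.sec ⊤) :
    (N.cotangent g).sec ⊤ :=
  N.ofFun g (Mor.pullRes N.ι ⊤ (Mor.pre (N.proj g) ⊤) (fun _ _ => trivial) φ -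
    Mor.pull (N.proj g) ⊤ (Mor.pullTop v φ)) <| by
    rw [map_sub, sub_eq_zero]
    have h1 := Mor.pullRes_comp N.sec N.ι v N.sec_ι (U := ⊤) (V := Mor.pre (N.proj g) ⊤)
      (W := Mor.pre N.sec (Mor.pre (N.proj g) ⊤)) (fun _ _ => trivial) le_rfl
      (fun _ _ => trivial) φ
    have h2 : (N.sec ≫ N.proj g) ≫ v = v := by
      rw [Thickening.proj, ← Category.assoc N.sec, N.sec_ι, hg, Category.id_comp]
    have h3 := Mor.pullRes_comp (N.sec ≫ N.proj g) v v h2 (U := ⊤) (V := ⊤)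
      (W := Mor.pre N.sec (Mor.pre (N.proj g) ⊤)) (fun _ _ => trivial) (fun _ _ => trivial)
      (fun _ _ => trivial) φ
    have h4 : ∀ x, Mor.pullRes N.sec (Mor.pre (N.proj g) ⊤) _ le_rfl x =
      Mor.pull N.sec (Mor.pre (N.proj g) ⊤) x := fun x => S.res_id _ _
    have h5 : ∀ x, Mor.pullRes (N.sec ≫ N.proj g) ⊤
      (Mor.pre N.sec (Mor.pre (N.proj g) ⊤)) (fun _ _ => trivial) x =
      Mor.pull N.sec (Mor.pre (N.proj g) ⊤) (Mor.pull (N.proj g) ⊤ x) := fun x => S.res_id _ _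
    rw [h4] at h1
    erw [h5] at h3
    exact h1.trans h3.symm

/-- The pull-back `v'^*Ω_{Y'/S} → v^*Ω_{Y/S}` of differential forms along a morphism of `S`-analytic
spaces `a : Y → Y'` that maps the section `v` to `v'`. -/
def Thickening.Hom.pullForm {Y' : AnalyticSpace K} {v' : S ⟶ Y'} {N : Thickening v}
    {N' : Thickening v'} {a : Y ⟶ Y'} (b : N.Hom N' a) (g : Y ⟶ S) (g' : Y' ⟶ S)
    (ha : a ≫ g' = g) {V : S.Dom} (m : (N'.cotangent g').sec V) : (N.cotangent g).sec V :=
  have hb : b.map ≫ N'.proj g' = N.proj g := by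
    rw [Thickening.proj, Thickening.proj, ← Category.assoc, b.map_ι, Category.assoc, ha]
  N.ofFun g (Mor.pullRes b.map (Mor.pre (N'.proj g') V) (Mor.pre (N.proj g) V)
    (Mor.le_pre_comp hb V) (N'.toFun g' m)) <| by
    have hle : Mor.pre N.sec (Mor.pre (N.proj g) V) ≤
        Mor.pre N'.sec (Mor.pre (N'.proj g') V) := by
      rw [← hb, ← b.sec_map]
      exact le_rfl
    have h1 := Mor.pullRes_comp N.sec b.map N'.sec b.sec_map
      (W := Mor.pre N.sec (Mor.pre (N.proj g) V)) (Mor.le_pre_comp hb V) le_rfl hle (N'.toFun g' m)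
    have h2 : Mor.pullRes N'.sec (Mor.pre (N'.proj g') V) _ hle (N'.toFun g' m) = 0 := by
      change S.res hle (Mor.pull N'.sec (Mor.pre (N'.proj g') V) (N'.toFun g' m)) = 0
      rw [N'.pull_toFun, map_zero]
    exact (S.res_id _ _).symm.trans (h1.trans h2)

end Cotangent

/-- The invariant differential form `dz/z` on the multiplicative group, as a section of its module
of invariant differentials. -/
def MultGroup.dlog {S : AnalyticSpace K} (G : MultGroup S) (G₁ : Thickening G.one) :
    (G₁.cotangent G.proj).sec ⊤ :=
  Mor.pullTop G.one ((G.z⁻¹ : (G.space.sec ⊤)ˣ) : G.space.sec ⊤) •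
    G₁.d G.proj (G.lift_proj (𝟙 S) 1) (G.z : G.space.sec ⊤)

/-! ### The projection `q` -/

section Projection

variable {S X : AnalyticSpace K} {f : X ⟶ S} {Λ : Type v} [AddCommGroup Λ]
  {L : LineBundleSystem Λ X} {P : ToricBundle L} {T : SplitTorus S Λ} {u : S ⟶ P.space}

theorem ToricBundle.orbit_over (f : X ⟶ S) (P : ToricBundle L) (T : SplitTorus S Λ)
    (u : S ⟶ P.space) (hu : (u ≫ P.proj) ≫ f = 𝟙 S) :
    P.orbit T u ≫ P.proj ≫ f = T.proj := by
  have h : P.orbit T u ≫ P.proj = (T.proj ≫ u) ≫ P.proj := P.lift_proj _ _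
  rw [← Category.assoc, h, Category.assoc, Category.assoc, ← Category.assoc u, hu,
    Category.comp_id]

/-- The `O_S`-linear map `q : j^*p^*(L χ) → ω_T ⊗ x^*(L χ)` is the projection defined by the
isomorphisms `j^*p^*(L χ) / i^*(L χ) ≅ u^*Ω_{P/X} ⊗ x^*(L χ)` and `u^*Ω_{P/X} ≅ ω_T`. That is to say,
`q` vanishes on the image of `i^*(L χ)`, and on the submodule `u^*Ω_{P/S} ⊗ x^*(L χ)`, where `φ ⊗ m|_S`
is the product `φ m`, it is the composite of `u^*Ω_{P/S} → u^*Ω_{P/X} ≅ ω_T` with the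
identity of `x^*(L χ)`; the last isomorphism being induced by the action of the torus, this composite
is the pull-back of differential forms along the orbit map `T → P`. -/
structure IsToricProjection (hu : (u ≫ P.proj) ≫ f = 𝟙 S) (P₁ : Thickening u)
    (X₁ : Thickening (u ≫ P.proj)) (T₁ : Thickening T.one) (p₁ : P₁.Hom X₁ P.proj)
    (a₁ : T₁.Hom P₁ (P.orbit T u)) (χ : Λ)
    (q : ((pullback (P₁.ι ≫ P.proj) (L.L χ)).pushforward (P₁.proj (P.proj ≫ f))).Hom
      (twist (T₁.cotangent T.proj) (u ≫ P.proj) (L.L χ))) : Prop where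
  vanish : ∀ (V : S.Dom) (m : (pullback X₁.ι (L.L χ)).sec (Mor.pre (X₁.proj f) V)),
    q.map V (pullSec p₁.map X₁.ι (P₁.ι ≫ P.proj) p₁.map_ι (L.L χ)
      (W := Mor.pre (P₁.proj (P.proj ≫ f)) V)
      (Mor.le_pre_comp (by
        rw [Thickening.proj, Thickening.proj, ← Category.assoc, p₁.map_ι, Category.assoc]) V)
      m) = 0
  form : ∀ (V : S.Dom) (φ : (P₁.cotangent (P.proj ≫ f)).sec V)
    (m : (pullback (P₁.ι ≫ P.proj) (L.L χ)).sec (Mor.pre (P₁.proj (P.proj ≫ f)) V)),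
    q.map V (P₁.toFun (P.proj ≫ f) φ • m) =
      tmul (a₁.pullForm T.proj (P.proj ≫ f) (P.orbit_over f T u hu) φ)
        (pullSec P₁.sec (P₁.ι ≫ P.proj) (u ≫ P.proj) (by rw [← Category.assoc, P₁.sec_ι])
          (L.L χ) (W := V)
          (show V ≤ Mor.pre P₁.sec (Mor.pre (P₁.proj (P.proj ≫ f)) V) from
            Mor.le_pre_comp (k := 𝟙 S) (by
              rw [Thickening.proj, ← Category.assoc, P₁.sec_ι, ← Category.assoc, hu]) V)
          m)

end Projection

end

end Berkovich

/-! Let `π : T₁ → S` be the projection of the first-order thickening of the torus and `a : T₁ → P₁`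
the morphism induced by the orbit map. The orbit map followed by `p` is `x` after the projection to
`S`. Hence, for a section `m` of `j^*p^*L_χ`, both `a^*m` and `π^*u^*m` are sections of the
pull-back of `x^*L_χ` to `T₁`. They agree on `S`, so their difference is a section of `ω_T ⊗
x^*L_χ`, and `q(m) = a^*m - π^*u^*m` is the required map (`toricProjection`).

If `m` comes from `X₁`, the difference vanishes because `p₁ ∘ a` and `p₁ ∘ u ∘ π` have the same
composite with the closed immersion `X₁ → X` (`IsClosedImmersion.pullRes_eq`). If `φ` vanishes on
`S`, then `q(φ m) = a^*φ · a^*m`. This equals `a^*φ · π^*u^*m`, because the ideal of `S` in `T₁` has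
square zero (`Thickening.mul_eq_zero`).

Uniqueness is local on `S`. Over the inverse image of the domain of a frame `ℓ` one writes `m = c
p^*ℓ` and splits `c` into a function coming from `S` and a function vanishing on `S`. The two
conditions prescribe `q` on the two summands (`IsToricProjection.map_eq_of_frame`). For this, the
part of `X₁` over a domain of `S` that `x` sends into `U` has to lie over `U`, which is true because
a thickening has no new points (`Thickening.sec_surjective`).

Finally `⟨χ, t u⟩ = χ(t) ⟨χ, u⟩` gives `q(⟨χ, j⟩) = (χ - 1) ⟨χ, u⟩`, and `χ - 1` represents
`χ^*(dz/z)` because `z` takes the value `1` at the neutral section. -/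

namespace Berkovich

variable {K : Type u} [NontriviallyNormedField K]

/-! ### Coverings for the G-topology and separation of functions. -/

section Coverings

/-- The analytic domains in `𝒰` that are contained in `Y` cover `Y` for the G-topology. -/
def NetSpace.Covers {X : NetSpace.{u}} (𝒰 : Set X.Dom) (Y : X.Dom) : Prop :=
  IsQuasiNet (NetSpace.Dom.carrier '' 𝒰) Y.1

theorem IsQuasiNet.preimage {X Y : Type u} [TopologicalSpace X] [TopologicalSpace Y] {f : X → Y}
    (hf : Continuous f) {τ : Set (Set Y)} {A : Set Y} (h : IsQuasiNet τ A) :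
    IsQuasiNet (Set.preimage f '' τ) (f ⁻¹' A) := by
  intro x hx
  obtain ⟨F, hF, hFτ, hFx, hFn⟩ := h (f x) hx
  refine ⟨Set.preimage f '' F, hF.image _, Set.image_mono hFτ, ?_, ?_⟩
  · rintro _ ⟨U, hU, rfl⟩
    exact ⟨(hFx U hU).1, Set.preimage_mono (hFx U hU).2⟩
  · have ht : Tendsto f (𝓝[f ⁻¹' A] x) (𝓝[A] f x) :=
      hf.continuousAt.continuousWithinAt.tendsto_nhdsWithin fun _ h => h
    rw [Set.sUnion_image, ← Set.preimage_iUnion₂, ← Set.sUnion_eq_biUnion]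
    exact ht hFn

theorem IsQuasiNet.inter_right {X : Type u} [TopologicalSpace X] {τ : Set (Set X)} {A B : Set X}
    (h : IsQuasiNet τ A) (hB : B ⊆ A) : IsQuasiNet ((· ∩ B) '' τ) B := by
  intro x hx
  obtain ⟨F, hF, hFτ, hFx, hFn⟩ := h x (hB hx)
  refine ⟨(· ∩ B) '' F, hF.image _, Set.image_mono hFτ, ?_, ?_⟩
  · rintro _ ⟨U, hU, rfl⟩
    exact ⟨⟨(hFx U hU).1, hx⟩, Set.inter_subset_right⟩
  · filter_upwards [nhdsWithin_mono x hB hFn, self_mem_nhdsWithin] with y hy hyB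
    obtain ⟨U, hU, hyU⟩ := hy
    exact ⟨_, ⟨U, hU, rfl⟩, hyU, hyB⟩

/-- The finite families provided by a quasi-net on `Y` consist of subsets of `Y`, so discarding all
other members of `𝒰` loses nothing. -/
theorem NetSpace.Covers.le {X : NetSpace.{u}} {𝒰 : Set X.Dom} {Y : X.Dom}
    (h : NetSpace.Covers 𝒰 Y) : NetSpace.Covers {U | U ∈ 𝒰 ∧ U ≤ Y} Y := by
  intro y hy
  obtain ⟨F, hF, hFτ, hFx, hFn⟩ := h y hy
  refine ⟨F, hF, fun U hU => ?_, hFx, hFn⟩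
  obtain ⟨Z, hZ, rfl⟩ := hFτ hU
  exact ⟨Z, ⟨hZ, (hFx _ hU).2⟩, rfl⟩

theorem NetSpace.Covers.inter {X : NetSpace.{u}} {𝒰 : Set X.Dom} {Y Z : X.Dom}
    (h : NetSpace.Covers 𝒰 Y) (hZ : Z ≤ Y) : NetSpace.Covers ((· ⊓ Z) '' 𝒰) Z := by
  have h' := IsQuasiNet.inter_right h hZ
  rw [Set.image_image] at h'
  rw [NetSpace.Covers, Set.image_image]
  exact h'

/-- This is the definition of an analytic domain; it reduces equalities of functions to affinoid
domains of the net, where closed immersions are understood. -/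
theorem NetSpace.covers_aff {X : NetSpace.{u}} (Y : X.Dom) :
    NetSpace.Covers {Z : X.Dom | Z.1 ∈ X.aff ∧ Z ≤ Y} Y := by
  refine NetSpace.Covers.le (𝒰 := {Z : X.Dom | Z.1 ∈ X.aff}) ?_
  have h : NetSpace.Dom.carrier '' {Z : X.Dom | Z.1 ∈ X.aff} = X.aff := by
    ext U
    constructor
    · rintro ⟨Z, hZ, rfl⟩
      exact hZ
    · exact fun hU => ⟨⟨U, NetSpace.isQuasiNet_of_mem hU⟩, hU, rfl⟩
  rw [NetSpace.Covers, h]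
  exact Y.2

theorem Mor.covers_preimage {X Y : AnalyticSpace K} (f : X ⟶ Y) {𝒰 : Set Y.Dom} {V : Y.Dom}
    (h : NetSpace.Covers 𝒰 V) : NetSpace.Covers (Mor.pre f '' 𝒰) (Mor.pre f V) := by
  have h' := IsQuasiNet.preimage (Mor.continuous f) h
  rw [Set.image_image] at h'
  rw [NetSpace.Covers, Set.image_image]
  exact h'

/-- Two functions that agree on the members of a covering are equal. -/
theorem AnalyticSpace.eq_of_covers {X : AnalyticSpace K} {𝒰 : Set X.Dom} {Y : X.Dom}
    (h𝒰 : NetSpace.Covers 𝒰 Y) {s t : X.sec Y}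
    (h : ∀ Z ∈ 𝒰, ∀ hZ : Z ≤ Y, X.res hZ s = X.res hZ t) : s = t := by
  have hc : NetSpace.IsGCover (fun Z : {Z : X.Dom // Z ∈ 𝒰 ∧ Z ≤ Y} => Z.1) Y := by
    refine ⟨fun Z => Z.2.2, fun y hy => ?_⟩
    obtain ⟨F, hF, hFτ, hFx, hFn⟩ := h𝒰 y hy
    refine ⟨F, hF, fun U hU => ?_, hFx, hFn⟩
    obtain ⟨Z, hZ, rfl⟩ := hFτ hU
    exact ⟨⟨Z, hZ, (hFx _ hU).2⟩, rfl⟩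
  -- Both `s` and `t` glue the family of restrictions of `s`, and gluing is unique.
  refine (X.glue _ Y hc (fun Z => X.res Z.2.2 s) fun i j => ?_).unique (fun _ => rfl)
    fun Z => (h Z.1 Z.2.1 Z.2.2).symm
  rw [X.res_res, X.res_res]

end Coverings

/-! ### Pull-back of functions to smaller domains. -/

section PullRes

variable {X Y Z : AnalyticSpace K}

theorem Mor.pullRes_self (f : X ⟶ Y) (V : Y.Dom) (h : Mor.pre f V ≤ Mor.pre f V) (s : Y.sec V) :
    Mor.pullRes f V (Mor.pre f V) h s = Mor.pull f V s :=
  X.res_id _ _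

theorem Mor.res_pull (f : X ⟶ Y) {V : Y.Dom} {W : X.Dom} (h : W ≤ Mor.pre f V) (s : Y.sec V) :
    X.res h (Mor.pull f V s) = Mor.pullRes f V W h s :=
  rfl

theorem Mor.pullRes_of_res (f : X ⟶ Y) {V V' : Y.Dom} {W : X.Dom} (hV : V' ≤ V)
    (h : W ≤ Mor.pre f V') (s : Y.sec V) :
    Mor.pullRes f V' W h (Y.res hV s) = Mor.pullRes f V W (h.trans (Mor.pre_mono f hV)) s :=
  (Mor.pullRes_res f (h.trans (Mor.pre_mono f hV)) h hV le_rfl s).trans (X.res_id _ _)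

theorem Mor.pullRes_id {V W : X.Dom} (k : X ⟶ X) (hk : k = 𝟙 X) (h : W ≤ Mor.pre k V) (hW : W ≤ V)
    (s : X.sec V) : Mor.pullRes k V W h s = X.res hW s := by
  subst hk
  rfl

theorem Mor.val_pullRes (f : X ⟶ Y) {V : Y.Dom} {W : X.Dom} (h : W ≤ Mor.pre f V) (x : W.1)
    (s : Y.sec V) :
    (X.val W x).1 (Mor.pullRes f V W h s) = (Y.val V ⟨Mor.base f x.1, h x.2⟩).1 s :=
  (X.val_res h x (Mor.pull f V s)).trans (Mor.val_app f V ⟨x.1, h x.2⟩ s)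

/-- Two pull-backs along morphisms to a closed subspace agree when they do so in the ambient
space, for functions on inverse images of domains of the ambient space. -/
theorem IsClosedImmersion.pullRes_eq {ι : Y ⟶ Z} (hι : IsClosedImmersion ι) {g h : X ⟶ Y}
    (hgh : g ≫ ι = h ≫ ι) {V : Z.Dom} {W : X.Dom} (hg : W ≤ Mor.pre g (Mor.pre ι V))
    (hh : W ≤ Mor.pre h (Mor.pre ι V)) (s : Y.sec (Mor.pre ι V)) :
    Mor.pullRes g _ W hg s = Mor.pullRes h _ W hh s := by
  have hc := ((Mor.covers_preimage (g ≫ ι) (NetSpace.covers_aff V)).inter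
    (show W ≤ Mor.pre (g ≫ ι) V from hg))
  refine AnalyticSpace.eq_of_covers hc ?_
  rintro _ ⟨_, ⟨A, ⟨hA, hAV⟩, rfl⟩, rfl⟩ hW
  have h1 : Mor.pre (g ≫ ι) A ⊓ W ≤ Mor.pre g (Mor.pre ι A) := inf_le_left
  have h2 : Mor.pre (g ≫ ι) A ⊓ W ≤ Mor.pre h (Mor.pre ι A) := by
    rw [hgh]
    exact inf_le_left
  -- Over an affinoid `A` of the net, `s` is the restriction of a function `ψ` of the ambient space.
  -- Both pull-backs of `s` are then the pull-back of `ψ` along the common composite `g ≫ ι = h ≫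
  -- ι`.
  obtain ⟨ψ, hψ⟩ := (hι A hA).2.surjective (Y.res (Mor.pre_mono ι hAV) s)
  have e1 := Mor.pullRes_of_res g (Mor.pre_mono ι hAV) h1 s
  have e2 := Mor.pullRes_of_res h (Mor.pre_mono ι hAV) h2 s
  rw [← hψ, ← Mor.pullRes_self ι A le_rfl] at e1 e2
  rw [Mor.pullRes_comp g ι _ rfl le_rfl h1 h1] at e1
  rw [Mor.pullRes_comp h ι _ hgh.symm le_rfl h2 h1] at e2
  rw [Mor.res_pullRes, Mor.res_pullRes]
  exact e1.symm.trans e2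

end PullRes

/-! ### Nilpotence of the ideal and points of a first-order thickening. -/

section Thickening

variable {S Y : AnalyticSpace K} {v : S ⟶ Y}

theorem Thickening.pre_sec_pre (N : Thickening v) (V : Y.Dom) :
    Mor.pre N.sec (Mor.pre N.ι V) = Mor.pre v V := by
  exact congrArg (Mor.pre · V) N.sec_ι

theorem Thickening.pull_sec_pullRes (N : Thickening v) {V : Y.Dom} {W : N.space.Dom}
    (hW : W ≤ Mor.pre N.ι V) {A : S.Dom} (hA : A ≤ Mor.pre N.sec W) (hA' : A ≤ Mor.pre v V)
    (ψ : Y.sec V) :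
    Mor.pullRes N.sec W A hA (Mor.pullRes N.ι V W hW ψ) = Mor.pullRes v V A hA' ψ :=
  Mor.pullRes_comp N.sec N.ι v N.sec_ι hW hA hA' ψ

/-- The ideal of `S` in the first-order thickening has square zero. -/
theorem Thickening.mul_eq_zero (N : Thickening v) {V : Y.Dom}
    {φ φ' : N.space.sec (Mor.pre N.ι V)} (h : Mor.pull N.sec (Mor.pre N.ι V) φ = 0)
    (h' : Mor.pull N.sec (Mor.pre N.ι V) φ' = 0) : φ * φ' = 0 := by
  refine AnalyticSpace.eq_of_covers (Mor.covers_preimage N.ι (NetSpace.covers_aff V)) ?_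
  rintro _ ⟨A, ⟨hA, hAV⟩, rfl⟩ hW
  have key : ∀ φ : N.space.sec (Mor.pre N.ι V), Mor.pull N.sec (Mor.pre N.ι V) φ = 0 →
      ∃ ψ : Y.sec A, ψ ∈ RingHom.ker (Mor.pull v A) ∧
        Mor.pull N.ι A ψ = N.space.res hW φ := by
    intro φ hφ
    -- Any lift of `φ` to the ambient affinoid vanishes on `S`, since `v` factors through the
    -- thickening.
    obtain ⟨ψ, hψ⟩ := (N.isClosedImmersion_ι A hA).2.surjective (N.space.res hW φ)
    refine ⟨ψ, ?_, hψ⟩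
    have hle : Mor.pre v A ≤ Mor.pre N.sec (Mor.pre N.ι A) := (N.pre_sec_pre A).ge
    have h1 := N.pull_sec_pullRes (V := A) le_rfl hle le_rfl ψ
    rw [Mor.pullRes_self, Mor.pullRes_self, hψ, Mor.pullRes_of_res, ← Mor.res_pull, hφ,
      map_zero] at h1
    exact h1.symm
  obtain ⟨ψ, hψ, e⟩ := key φ h
  obtain ⟨ψ', hψ', e'⟩ := key φ' h'
  rw [map_mul, map_zero, ← e, ← e', ← map_mul]
  have hm : ψ * ψ' ∈ RingHom.ker (Mor.pull N.ι A) := by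
    rw [N.ideal A hA, pow_two]
    exact Ideal.mul_mem_mul hψ hψ'
  exact hm

theorem Spectrum.sub_eq {A : Type u} [CommRing A] [TopologicalSpace A] [Algebra K A]
    (p : Spectrum K A) {a b : A} (h : p.1 (a - b) = 0) : p.1 a = p.1 b := by
  have h1 := abs_sub_map_le_sub p.1 a b
  rw [h] at h1
  exact sub_eq_zero.1 (abs_nonpos_iff.1 h1)

/-- A thickening has the same points as the space that is thickened. -/
theorem Thickening.sec_surjective (N : Thickening v) : Function.Surjective (Mor.base N.sec) := by
  intro y
  obtain ⟨F, -, hF, -, hFn⟩ := Y.cover (Mor.base N.ι y) trivial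
  obtain ⟨A, hAF, hyA⟩ := mem_of_mem_nhdsWithin (Set.mem_univ _) hFn
  have hA := hF hAF
  obtain ⟨V, rfl⟩ : ∃ V : Y.Dom, V.1 = A := ⟨⟨A, NetSpace.isQuasiNet_of_mem hA⟩, rfl⟩
  obtain ⟨hN, hNq⟩ := N.isClosedImmersion_ι V hA
  obtain ⟨hS, hSq⟩ := N.isClosedImmersion V hA
  set p := N.space.val (Mor.pre N.ι V) ⟨y, hyA⟩
  have hle : Mor.pre v V ≤ Mor.pre N.sec (Mor.pre N.ι V) := (N.pre_sec_pre V).ge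
  have hle' : Mor.pre N.sec (Mor.pre N.ι V) ≤ Mor.pre v V := (N.pre_sec_pre V).le
  -- A function vanishing on `S` has square zero on the thickening, so every multiplicative seminorm
  -- kills it.
  have hpull : ∀ ψ, Mor.pull v V ψ = 0 → p.1 (Mor.pull N.ι V ψ) = 0 := by
    intro ψ hψ
    have h1 : Mor.pull N.sec (Mor.pre N.ι V) (Mor.pull N.ι V ψ) = 0 := by
      have h1 := N.pull_sec_pullRes (V := V) le_rfl le_rfl hle' ψ
      rw [Mor.pullRes_self, Mor.pullRes_self, ← Mor.res_pull, hψ, map_zero] at h1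
      exact h1
    have h2 := congrArg p.1 (N.mul_eq_zero h1 h1)
    rw [map_mul, map_zero] at h2
    exact mul_self_eq_zero.1 h2
  have hwd : ∀ ψ ψ', Mor.pull v V ψ = Mor.pull v V ψ' →
      p.1 (Mor.pull N.ι V ψ) = p.1 (Mor.pull N.ι V ψ') := by
    intro ψ ψ' h
    refine p.sub_eq ?_
    rw [← map_sub]
    exact hpull _ (by rw [map_sub, h, sub_self])
  -- The seminorm of the point `y` therefore descends along the surjection `O_Y(V) → O_S(v⁻¹(V))`.
  -- The choice of preimages is immaterial by `hwd`.
  let r : S.sec (Mor.pre v V) → ℝ := fun s =>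
    p.1 (Mor.pull N.ι V (Function.surjInv hSq.surjective s))
  have hr : ∀ ψ, r (Mor.pull v V ψ) = p.1 (Mor.pull N.ι V ψ) := fun ψ =>
    hwd _ _ (Function.surjInv_eq hSq.surjective _)
  let ρ : Spectrum K (S.sec (Mor.pre v V)) :=
    ⟨{  toFun := r
        map_zero' := by rw [← map_zero (Mor.pull v V), hr, map_zero, map_zero]
        map_one' := by rw [← map_one (Mor.pull v V), hr, map_one, map_one]
        add_le' := fun s t => by
          obtain ⟨s, rfl⟩ := hSq.surjective s
          obtain ⟨t, rfl⟩ := hSq.surjective t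
          rw [← map_add, hr, hr, hr, map_add]
          exact map_add_le_add _ _ _
        map_mul' := fun s t => by
          obtain ⟨s, rfl⟩ := hSq.surjective s
          obtain ⟨t, rfl⟩ := hSq.surjective t
          rw [← map_mul, hr, hr, hr, map_mul, map_mul]
        neg' := fun s => by
          obtain ⟨s, rfl⟩ := hSq.surjective s
          rw [← map_neg, hr, hr, map_neg, map_neg_eq_map] }, by
      -- The surjection is a topological quotient map, so continuity can be tested on `O_Y(V)`.
      change Continuous r
      rw [hSq.isQuotientMap.continuous_iff]
      have h : r ∘ Mor.pull v V = p.1 ∘ Mor.pull N.ι V := funext hr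
      rw [h]
      exact p.2.1.comp (Mor.pull N.ι V).continuous, fun k => by
      change r _ = _
      rw [← (Mor.pull v V).toAlgHom.commutes k]
      exact (hr _).trans ((congrArg p.1 ((Mor.pull N.ι V).toAlgHom.commutes k)).trans (p.2.2 k))⟩
  -- The inverse image of `V` in `S` is affinoid, so the descended seminorm is evaluation at a point
  -- of `S`. That point maps to `y` because points of the affinoid `Mor.pre N.ι V` are separated by
  -- their seminorms.
  obtain ⟨s, hs⟩ := hS.2.1.surjective ρ
  refine ⟨s.1, ?_⟩
  have key : N.space.val (Mor.pre N.ι V) ⟨Mor.base N.sec s.1, hle s.2⟩ = p := by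
    refine Subtype.ext (DFunLike.ext _ _ fun φ => ?_)
    obtain ⟨ψ, rfl⟩ := hNq.surjective φ
    rw [← Mor.val_pullRes N.sec hle s, ← Mor.pullRes_self N.ι V le_rfl,
      N.pull_sec_pullRes le_rfl hle le_rfl, hs, Mor.pullRes_self, Mor.pullRes_self]
    exact hr ψ
  exact congrArg Subtype.val (hN.2.1.injective key)

/-- The thickening of the inverse image of a domain `U` along the section `v` is contained in `U`. -/
theorem Thickening.pre_proj_pre_le (N : Thickening v) (g : Y ⟶ S) (hg : v ≫ g = 𝟙 S) (U : Y.Dom) :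
    Mor.pre (N.proj g) (Mor.pre v U) ≤ Mor.pre N.ι U := by
  intro y hy
  -- Every point comes from `S`, where the projection is the identity, so the claim becomes a
  -- statement about `v`.
  obtain ⟨s, rfl⟩ := N.sec_surjective y
  have h : N.sec ≫ N.proj g = 𝟙 S := by rw [Thickening.proj, ← Category.assoc, N.sec_ι, hg]
  have hs : s ∈ (Mor.pre (N.sec ≫ N.proj g) (Mor.pre v U)).1 := hy
  rw [h] at hs
  have hs' : s ∈ (Mor.pre v U).1 := hs
  rw [← N.pre_sec_pre] at hs'
  exact hs'

end Thickening

/-! ### Cotangent modules and the difference of two pull-backs of a function. -/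

section Cotangent

variable {S Y : AnalyticSpace K} {v : S ⟶ Y}

theorem Thickening.cotangent_ext (N : Thickening v) (g : Y ⟶ S) {V : S.Dom}
    {m m' : (N.cotangent g).sec V} (h : N.toFun g m = N.toFun g m') : m = m' :=
  Subtype.ext h

theorem Thickening.toFun_smul (N : Thickening v) (g : Y ⟶ S) {V : S.Dom} (c : S.sec V)
    (m : (N.cotangent g).sec V) :
    N.toFun g (c • m) = Mor.pull (N.proj g) V c * N.toFun g m :=
  rfl

theorem Thickening.toFun_res (N : Thickening v) (g : Y ⟶ S) {V W : S.Dom} (h : W ≤ V)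
    (m : (N.cotangent g).sec V) :
    N.toFun g ((N.cotangent g).res h m) =
      N.space.res (Mor.pre_mono (N.proj g) h) (N.toFun g m) :=
  rfl

theorem Thickening.toFun_add (N : Thickening v) (g : Y ⟶ S) {V : S.Dom}
    (m m' : (N.cotangent g).sec V) :
    N.toFun g (m + m') = N.toFun g m + N.toFun g m' :=
  rfl

theorem Thickening.toFun_ofFun (N : Thickening v) (g : Y ⟶ S) {V : S.Dom}
    (φ : N.space.sec (Mor.pre (N.proj g) V))
    (h : Mor.pull N.sec (Mor.pre (N.proj g) V) φ = 0) : N.toFun g (N.ofFun g φ h) = φ :=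
  rfl

theorem Thickening.toFun_d (N : Thickening v) (g : Y ⟶ S) (hg : v ≫ g = 𝟙 S) (φ : Y.sec ⊤) :
    N.toFun g (N.d g hg φ) =
      Mor.pullRes N.ι ⊤ (Mor.pre (N.proj g) ⊤) (fun _ _ => trivial) φ -
        Mor.pull (N.proj g) ⊤ (Mor.pullTop v φ) :=
  rfl

theorem Thickening.sec_proj (N : Thickening v) (g : Y ⟶ S) (hg : v ≫ g = 𝟙 S) :
    N.sec ≫ N.proj g = 𝟙 S := by
  rw [Thickening.proj, ← Category.assoc, N.sec_ι, hg]

theorem Thickening.le_pre_sec_pre_proj (N : Thickening v) (g : Y ⟶ S) (hg : v ≫ g = 𝟙 S)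
    (V : S.Dom) : V ≤ Mor.pre N.sec (Mor.pre (N.proj g) V) :=
  Mor.le_pre_comp (N.sec_proj g hg) V

theorem Thickening.pre_sec_pre_proj_le (N : Thickening v) (g : Y ⟶ S) (hg : v ≫ g = 𝟙 S)
    (V : S.Dom) : Mor.pre N.sec (Mor.pre (N.proj g) V) ≤ V := by
  exact (congrArg (Mor.pre · V) (N.sec_proj g hg)).le

/-- The inverse image of `V` in the thickening is also that of the domain `Mor.pre g V` of `Y`, so
the square-zero property applies. -/
theorem Thickening.toFun_mul_toFun (N : Thickening v) (g : Y ⟶ S) {V : S.Dom}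
    (m m' : (N.cotangent g).sec V) : N.toFun g m * N.toFun g m' = 0 :=
  N.mul_eq_zero (V := Mor.pre g V) (N.pull_toFun g m) (N.pull_toFun g m')

/-- Sections of the cotangent module are determined by their restrictions to a covering. -/
theorem Thickening.cotangent_eq_of_covers (N : Thickening v) (g : Y ⟶ S) {𝒰 : Set S.Dom}
    {V : S.Dom} (h𝒰 : NetSpace.Covers 𝒰 V) {m m' : (N.cotangent g).sec V}
    (h : ∀ W ∈ 𝒰, ∀ hW : W ≤ V, (N.cotangent g).res hW m = (N.cotangent g).res hW m') :
    m = m' := by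
  refine N.cotangent_ext g (AnalyticSpace.eq_of_covers
    (Mor.covers_preimage (N.proj g) h𝒰.le) ?_)
  rintro _ ⟨W, ⟨hW, hWV⟩, rfl⟩ hle
  exact congrArg (N.toFun g) (h W hW hWV)

variable {Y' : AnalyticSpace K} {v' : S ⟶ Y'} {N : Thickening v} {N' : Thickening v'}
  {a : Y ⟶ Y'}

/-- The difference between the pull-back along `b` of a function `φ` and the pull-back along the
projection to `S` of the restriction of `φ` to `S`. -/
noncomputable def Thickening.Hom.variationFun (b : N.Hom N' a) (g : Y ⟶ S) (hg : v ≫ g = 𝟙 S)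
    {E : N'.space.Dom} {W : S.Dom} (h₁ : Mor.pre (N.proj g) W ≤ Mor.pre b.map E)
    (h₂ : W ≤ Mor.pre N'.sec E) (φ : N'.space.sec E) : (N.cotangent g).sec W :=
  N.ofFun g (Mor.pullRes b.map E (Mor.pre (N.proj g) W) h₁ φ -
    Mor.pull (N.proj g) W (Mor.pullRes N'.sec E W h₂ φ)) <| by
    -- On `S` both terms become the restriction of `φ`: `b` carries one section to the other, and
    -- the projection composed with the section is the identity.
    have hle := N.pre_sec_pre_proj_le g hg W
    have h1 := Mor.pullRes_comp N.sec b.map N'.sec b.sec_map h₁ le_rfl (hle.trans h₂) φ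
    have h2 := Mor.pullRes_comp N.sec (N.proj g) _ (N.sec_proj g hg) (U := W) le_rfl le_rfl hle
      (Mor.pullRes N'.sec E W h₂ φ)
    rw [Mor.pullRes_self] at h1
    rw [Mor.pullRes_self, Mor.pullRes_self] at h2
    rw [map_sub, h1, sub_eq_zero]
    exact (h2.trans ((Mor.pullRes_id (𝟙 S) rfl hle hle _).trans (Mor.res_pullRes _ _ _ _))).symm

theorem Thickening.Hom.toFun_variationFun (b : N.Hom N' a) (g : Y ⟶ S) (hg : v ≫ g = 𝟙 S)
    {E : N'.space.Dom} {W : S.Dom} (h₁ : Mor.pre (N.proj g) W ≤ Mor.pre b.map E)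
    (h₂ : W ≤ Mor.pre N'.sec E) (φ : N'.space.sec E) :
    N.toFun g (b.variationFun g hg h₁ h₂ φ) = Mor.pullRes b.map E (Mor.pre (N.proj g) W) h₁ φ -
      Mor.pull (N.proj g) W (Mor.pullRes N'.sec E W h₂ φ) :=
  rfl

theorem Thickening.Hom.variationFun_add (b : N.Hom N' a) (g : Y ⟶ S) (hg : v ≫ g = 𝟙 S)
    {E : N'.space.Dom} {W : S.Dom} (h₁ : Mor.pre (N.proj g) W ≤ Mor.pre b.map E)
    (h₂ : W ≤ Mor.pre N'.sec E) (φ φ' : N'.space.sec E) :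
    b.variationFun g hg h₁ h₂ (φ + φ') =
      b.variationFun g hg h₁ h₂ φ + b.variationFun g hg h₁ h₂ φ' := by
  refine N.cotangent_ext g ?_
  simp only [N.toFun_add, b.toFun_variationFun, map_add]
  ring

theorem Thickening.Hom.variationFun_res (b : N.Hom N' a) (g : Y ⟶ S) (hg : v ≫ g = 𝟙 S)
    {E E' : N'.space.Dom} {W W' : S.Dom} (h₁ : Mor.pre (N.proj g) W ≤ Mor.pre b.map E)
    (h₂ : W ≤ Mor.pre N'.sec E) (h₁' : Mor.pre (N.proj g) W' ≤ Mor.pre b.map E')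
    (h₂' : W' ≤ Mor.pre N'.sec E') (hE : E' ≤ E) (hW : W' ≤ W) (φ : N'.space.sec E) :
    b.variationFun g hg h₁' h₂' (N'.space.res hE φ) =
      (N.cotangent g).res hW (b.variationFun g hg h₁ h₂ φ) := by
  refine N.cotangent_ext g ?_
  rw [N.toFun_res, b.toFun_variationFun, b.toFun_variationFun, map_sub,
    Mor.pullRes_res b.map h₁ h₁' hE (Mor.pre_mono _ hW), Mor.pullRes_res N'.sec h₂ h₂' hE hW,
    Mor.pull_res]

/-- Multiplication by a function that is constant along the projections to `S`. -/
theorem Thickening.Hom.variationFun_mul (b : N.Hom N' a) (g : Y ⟶ S) (hg : v ≫ g = 𝟙 S)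
    {E : N'.space.Dom} {W : S.Dom} (h₁ : Mor.pre (N.proj g) W ≤ Mor.pre b.map E)
    (h₂ : W ≤ Mor.pre N'.sec E) (c : S.sec W) (ψ φ : N'.space.sec E)
    (hb : Mor.pullRes b.map E (Mor.pre (N.proj g) W) h₁ ψ = Mor.pull (N.proj g) W c)
    (hs : Mor.pullRes N'.sec E W h₂ ψ = c) :
    b.variationFun g hg h₁ h₂ (ψ * φ) = c • b.variationFun g hg h₁ h₂ φ := by
  refine N.cotangent_ext g ?_
  rw [N.toFun_smul, b.toFun_variationFun, b.toFun_variationFun, map_mul, map_mul, hb, hs, map_mul]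
  ring

end Cotangent

/-! ### Sections of twisted modules through their coordinates. -/

section Twist

variable {X' X : AnalyticSpace K}

theorem twist_ext {M : PreMod X'} {f : X' ⟶ X} {L : LineBundle X} {V : X'.Dom}
    {s t : (twist M f L).sec V} (h : ∀ (U : X.Dom) (ℓ : L.Frame U),
      (show twistSec M f L V from s).1 U ℓ = (show twistSec M f L V from t).1 U ℓ) : s = t :=
  Subtype.ext (funext fun U => funext fun ℓ => h U ℓ)

theorem pullback.coord_frame_res {f : X' ⟶ X} {L : LineBundle X} {V : X'.Dom}
    (s : (pullback f L).sec V) {U W : X.Dom} (h : W ≤ U) (ℓ : L.Frame U) :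
    pullback.coord s (ℓ.res h) =
      X'.res (inf_le_inf_left V (Mor.pre_mono f h)) (pullback.coord s ℓ) :=
  s.2.res U W h ℓ

theorem pullback.coord_frame_smul {f : X' ⟶ X} {L : LineBundle X} {V : X'.Dom}
    (s : (pullback f L).sec V) {U : X.Dom} (ℓ ℓ' : L.Frame U) (a : X.sec U)
    (h : ℓ'.1 = a • ℓ.1) :
    pullback.coord s ℓ =
      Mor.pullRes f U (V ⊓ Mor.pre f U) inf_le_right a * pullback.coord s ℓ' :=
  s.2.smul U ℓ ℓ' a h

/-- A section of a twist of the cotangent module is determined by its restrictions to a covering. -/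
theorem Thickening.twist_eq_of_covers {S Y : AnalyticSpace K} {v : S ⟶ Y} (N : Thickening v)
    (g : Y ⟶ S) (x : S ⟶ X) (L : LineBundle X) {𝒰 : Set S.Dom} {V : S.Dom}
    (h𝒰 : NetSpace.Covers 𝒰 V) {s t : (twist (N.cotangent g) x L).sec V}
    (h : ∀ W ∈ 𝒰, ∀ hW : W ≤ V, (twist (N.cotangent g) x L).res hW s =
      (twist (N.cotangent g) x L).res hW t) : s = t := by
  refine twist_ext fun U ℓ => ?_
  refine N.cotangent_eq_of_covers g (h𝒰.le.inter (Z := V ⊓ Mor.pre x U) inf_le_left) ?_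
  rintro _ ⟨W, ⟨hW, hWV⟩, rfl⟩ hle
  have h1 := congrArg (fun r : twistSec (N.cotangent g) x L W =>
    (N.cotangent g).res (show W ⊓ (V ⊓ Mor.pre x U) ≤ W ⊓ Mor.pre x U from
      inf_le_inf_left W inf_le_right) (r.1 U ℓ)) (h W hW hWV)
  exact ((N.cotangent g).res_res _ _ _).symm.trans (h1.trans ((N.cotangent g).res_res _ _ _))

end Twist

/-! ### Ratios and pull-backs of frames. -/

section Frames

variable {X' X : AnalyticSpace K}

theorem PreMod.Frame.exists_smul_eq {M : PreMod X} {W : X.Dom} (ℓ ℓ' : M.Frame W) :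
    ∃ a : X.sec W, a • ℓ'.1 = ℓ.1 := by
  obtain ⟨a, ha⟩ := (ℓ'.2 W le_rfl).surjective ℓ.1
  exact ⟨a, by simpa only [M.res_id] using ha⟩

/-- The function `a` such that `ℓ = a ℓ'`, for two frames of a module. -/
noncomputable def PreMod.Frame.ratio {M : PreMod X} {W : X.Dom} (ℓ ℓ' : M.Frame W) : X.sec W :=
  (PreMod.Frame.exists_smul_eq ℓ ℓ').choose

theorem PreMod.Frame.ratio_smul {M : PreMod X} {W : X.Dom} (ℓ ℓ' : M.Frame W) :
    PreMod.Frame.ratio ℓ ℓ' • ℓ'.1 = ℓ.1 :=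
  (PreMod.Frame.exists_smul_eq ℓ ℓ').choose_spec

theorem PreMod.Frame.smul_injective {M : PreMod X} {W : X.Dom} (ℓ : M.Frame W) {a b : X.sec W}
    (h : a • ℓ.1 = b • ℓ.1) : a = b :=
  (ℓ.2 W le_rfl).injective (by simpa only [M.res_id] using h)

theorem PreMod.Frame.res_ratio {M : PreMod X} {U W : X.Dom} (h : W ≤ U) (ℓ ℓ' : M.Frame U) :
    X.res h (PreMod.Frame.ratio ℓ ℓ') = PreMod.Frame.ratio (ℓ.res h) (ℓ'.res h) := by
  refine PreMod.Frame.smul_injective (ℓ'.res h) ?_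
  rw [PreMod.Frame.ratio_smul]
  exact (M.res_smul h _ _).symm.trans (congrArg (M.res h) (PreMod.Frame.ratio_smul ℓ ℓ'))

theorem PreMod.Frame.res_res {M : PreMod X} {U V W : X.Dom} (h : V ≤ U) (h' : W ≤ V)
    (ℓ : M.Frame U) : (ℓ.res h).res h' = ℓ.res (h'.trans h) :=
  Subtype.ext (M.res_res h h' ℓ.1)

/-- The pull-back `f^*ℓ` of a frame. -/
noncomputable def pullFrame (f : X' ⟶ X) (L : LineBundle X) {U : X.Dom} (ℓ : L.Frame U)
    (V : X'.Dom) (hV : V ≤ Mor.pre f U) : (pullback f L).sec V :=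
  -- If `ℓ = a ℓ'` over `U ⊓ U'`, the coordinate of `f^*ℓ` with respect to `ℓ'` is `f^*a`. It is
  -- defined on all of `V ⊓ f⁻¹(U')` because `V` maps into `U`.
  ⟨fun U' ℓ' => Mor.pullRes f (U ⊓ U') (V ⊓ Mor.pre f U') (inf_le_inf_right _ hV)
      (PreMod.Frame.ratio (ℓ.res inf_le_left) (ℓ'.res inf_le_right)),
    { res := fun U' W h ℓ' => by
        refine (congrArg (Mor.pullRes f (U ⊓ W) (V ⊓ Mor.pre f W) (inf_le_inf_right _ hV))
          ?_).trans (Mor.pullRes_res f (inf_le_inf_right _ hV) (inf_le_inf_right _ hV)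
            (inf_le_inf_left U h) (inf_le_inf_left V (Mor.pre_mono f h)) _)
        rw [PreMod.Frame.res_ratio, PreMod.Frame.res_res, PreMod.Frame.res_res,
          PreMod.Frame.res_res]
      smul := fun U' ℓ' ℓ'' a ha => by
        have h : PreMod.Frame.ratio (ℓ.res inf_le_left : L.Frame (U ⊓ U')) (ℓ'.res inf_le_right) =
            X.res inf_le_right a *
              PreMod.Frame.ratio (ℓ.res inf_le_left) (ℓ''.res inf_le_right) := by
          refine PreMod.Frame.smul_injective (ℓ'.res inf_le_right) ?_
          rw [PreMod.Frame.ratio_smul, mul_comm, mul_smul]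
          refine (PreMod.Frame.ratio_smul _ (ℓ''.res inf_le_right)).symm.trans ?_
          refine congrArg (_ • ·) ?_
          exact (congrArg (L.res _) ha).trans (L.res_smul _ _ _)
        rw [h]
        refine (map_mul (Mor.pullRes f (U ⊓ U') (V ⊓ Mor.pre f U') _) _ _).trans ?_
        exact congrArg (· * _) (Mor.pullRes_of_res f inf_le_right (inf_le_inf_right _ hV) a) }⟩

theorem pullSec_pullFrame {X'' : AnalyticSpace K} (g : X'' ⟶ X') (f : X' ⟶ X) (k : X'' ⟶ X)
    (hk : g ≫ f = k) (L : LineBundle X) {V : X'.Dom} {W : X''.Dom} (hW : W ≤ Mor.pre g V)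
    {U : X.Dom} (ℓ : L.Frame U) (hV : V ≤ Mor.pre f U) (hW' : W ≤ Mor.pre k U) :
    pullSec g f k hk L hW (pullFrame f L ℓ V hV) = pullFrame k L ℓ W hW' := by
  refine twist_ext fun U' ℓ' => ?_
  exact Mor.pullRes_comp g f k hk _ _ _ _

theorem pullSec_smul {X'' : AnalyticSpace K} (g : X'' ⟶ X') (f : X' ⟶ X) (k : X'' ⟶ X)
    (hk : g ≫ f = k) (L : LineBundle X) {V : X'.Dom} {W : X''.Dom} (hW : W ≤ Mor.pre g V)
    (c : X'.sec V) (s : (pullback f L).sec V) :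
    pullSec g f k hk L hW (c • s) = Mor.pullRes g V W hW c • pullSec g f k hk L hW s := by
  refine twist_ext fun U' ℓ' => ?_
  refine (map_mul (Mor.pullRes g _ _ _) _ _).trans ?_
  exact congrArg (· * _) ((Mor.pullRes_of_res g _ _ _).trans (Mor.res_pullRes g _ _ _).symm)

/-- A section of `f^*L` over a domain that maps to the domain of a frame is a multiple of the
pull-back of that frame. -/
theorem exists_smul_pullFrame (f : X' ⟶ X) (L : LineBundle X) {U : X.Dom} (ℓ : L.Frame U)
    {V : X'.Dom} (hV : V ≤ Mor.pre f U) (s : (pullback f L).sec V) :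
    ∃ c : X'.sec V, s = c • pullFrame f L ℓ V hV := by
  -- The multiplier is the coordinate of `s` with respect to `ℓ` itself, which lives on `V ⊓ f⁻¹(U)`
  -- and hence on `V`.
  refine ⟨X'.res (le_inf le_rfl hV) (pullback.coord s ℓ), twist_ext fun U' ℓ' => ?_⟩
  have h1 := pullback.coord_frame_smul s (ℓ'.res inf_le_right) (ℓ.res inf_le_left)
    (PreMod.Frame.ratio (ℓ.res inf_le_left) (ℓ'.res (inf_le_right : U ⊓ U' ≤ U')))
    (PreMod.Frame.ratio_smul _ _).symm
  have hle : V ⊓ Mor.pre f U' ≤ V ⊓ Mor.pre f (U ⊓ U') :=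
    le_inf inf_le_left (inf_le_inf_right _ hV)
  rw [pullback.coord_frame_res, pullback.coord_frame_res] at h1
  have h2 := congrArg (X'.res hle) h1
  rw [map_mul, X'.res_res, X'.res_res, X'.res_id, Mor.res_pullRes] at h2
  refine h2.trans ?_
  refine (mul_comm _ _).trans (congrArg (· * _) ?_)
  exact (X'.res_res _ _ _).symm

end Frames

/-! ### The difference of two pull-backs as a homomorphism of modules. -/

section Variation

variable {S X Y Y' : AnalyticSpace K} {v : S ⟶ Y} {v' : S ⟶ Y'} {N : Thickening v}
  {N' : Thickening v'} {a : Y ⟶ Y'}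

theorem Thickening.Hom.map_proj (b : N.Hom N' a) {g : Y ⟶ S} {g' : Y' ⟶ S} (ha : a ≫ g' = g) :
    b.map ≫ N'.proj g' = N.proj g := by
  rw [Thickening.proj, Thickening.proj, ← Category.assoc, b.map_ι, Category.assoc, ha]

theorem Thickening.Hom.toFun_pullForm (b : N.Hom N' a) (g : Y ⟶ S) (g' : Y' ⟶ S)
    (ha : a ≫ g' = g) {V : S.Dom} (m : (N'.cotangent g').sec V) :
    N.toFun g (b.pullForm g g' ha m) = Mor.pullRes b.map (Mor.pre (N'.proj g') V)
      (Mor.pre (N.proj g) V) (Mor.le_pre_comp (b.map_proj ha) V) (N'.toFun g' m) :=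
  rfl

/-- With `Thickening.inf_le_pre_sec`, this ensures that a coordinate of a section of `k^*L` can be
pulled back to the domain where the matching coordinate of a section of `ω ⊗ x^*L` lives, both along
`b` and from `S`. -/
theorem Thickening.Hom.pre_inf_le (b : N.Hom N' a) {g : Y ⟶ S} {g' : Y' ⟶ S} (ha : a ≫ g' = g)
    {k : N'.space ⟶ X} {x : S ⟶ X} (hk : b.map ≫ k = N.proj g ≫ x) (V : S.Dom) (U : X.Dom) :
    Mor.pre (N.proj g) (V ⊓ Mor.pre x U) ≤
      Mor.pre b.map (Mor.pre (N'.proj g') V ⊓ Mor.pre k U) :=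
  (inf_le_inf (Mor.le_pre_comp (b.map_proj ha) V) (Mor.le_pre_comp hk U) :
    Mor.pre (N.proj g) V ⊓ Mor.pre (N.proj g ≫ x) U ≤ _ ⊓ _)

theorem Thickening.inf_le_pre_sec (N : Thickening v) {g : Y ⟶ S} (hg : v ≫ g = 𝟙 S)
    {k : N.space ⟶ X} {x : S ⟶ X} (hx : N.sec ≫ k = x) (V : S.Dom) (U : X.Dom) :
    V ⊓ Mor.pre x U ≤ Mor.pre N.sec (Mor.pre (N.proj g) V ⊓ Mor.pre k U) :=
  (inf_le_inf (N.le_pre_sec_pre_proj g hg V) (Mor.le_pre_comp hx U) : _ ≤ _ ⊓ _)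

/-- Given a morphism `b` of first-order thickenings `N → N'` over `S` and a morphism `k` from `N'`
such that `b ≫ k` factors as `x` after the projection to `S`, the `O_S`-linear map that takes a
section `m` of `k^*L` to the difference between its pull-back along `b` and the pull-back of its
restriction to `S`. -/
noncomputable def Thickening.Hom.variation (b : N.Hom N' a) (g : Y ⟶ S) (g' : Y' ⟶ S)
    (ha : a ≫ g' = g) (hg : v ≫ g = 𝟙 S) (hg' : v' ≫ g' = 𝟙 S) (k : N'.space ⟶ X) (x : S ⟶ X)
    (hk : b.map ≫ k = N.proj g ≫ x) (hx : N'.sec ≫ k = x) (L : LineBundle X) :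
    ((pullback k L).pushforward (N'.proj g')).Hom (twist (N.cotangent g) x L) :=
  { map := fun V =>
      { toFun := fun m => ⟨fun U ℓ => b.variationFun g hg (b.pre_inf_le ha hk V U)
            (N'.inf_le_pre_sec hg' hx V U)
            (pullback.coord (show (pullback k L).sec (Mor.pre (N'.proj g') V) from m) ℓ),
          { res := fun U W h ℓ => by
              rw [pullback.coord_frame_res]
              exact b.variationFun_res g hg _ _ _ _ _ _ _
            smul := fun U ℓ ℓ' c hc => by
              rw [pullback.coord_frame_smul _ ℓ ℓ' c hc]
              -- A change of frame multiplies coordinates by a function on `X`. As `b ≫ k` factors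
              -- through `x`, its pull-back along `b` comes from `S`, so it can be taken out of the
              -- difference.
              refine b.variationFun_mul g hg _ _ _ _ _ ?_ ?_
              · rw [Mor.pullRes_comp b.map k _ hk _ _ (show _ ≤ Mor.pre (N.proj g) (Mor.pre x U)
                  from Mor.pre_mono _ inf_le_right)]
                rw [← Mor.pullRes_self (N.proj g) _ le_rfl]
                exact (Mor.pullRes_comp (N.proj g) x _ rfl _ _ _ _).symm
              · exact Mor.pullRes_comp _ _ _ hx _ _ _ _ }⟩
        map_add' := fun m m' => twist_ext fun U ℓ => b.variationFun_add g hg _ _ _ _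
        map_smul' := fun c m => twist_ext fun U ℓ => by
          -- Linearity: `b` is a morphism over `S`, so functions on `S` can be taken out in the same
          -- way.
          refine b.variationFun_mul g hg _ _ _ _ _ ?_ ?_
          · refine (Mor.pullRes_comp b.map (N'.proj g') _ (b.map_proj ha) inf_le_left (b.pre_inf_le ha hk V U)
              (Mor.pre_mono _ inf_le_left) c).trans ?_
            exact (Mor.pull_res (N.proj g) inf_le_left c).symm
          · exact Mor.pullRes_comp N'.sec (N'.proj g') _ (N'.sec_proj g' hg') inf_le_left (N'.inf_le_pre_sec hg' hx V U)
              inf_le_left c }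
    map_res := fun {V W} h m => twist_ext fun U ℓ => b.variationFun_res g hg _ _ _ _ _ _ _ }

end Variation

theorem LineBundle.covers_frame {X : AnalyticSpace K} (L : LineBundle X) :
    NetSpace.Covers {U : X.Dom | Nonempty (L.Frame U)} ⊤ := by
  have h : NetSpace.Dom.carrier '' {U : X.Dom | Nonempty (L.Frame U)} =
      {A | ∃ V : X.Dom, V.1 = A ∧ Nonempty (L.Frame V)} := by
    ext A
    exact exists_congr fun V => and_comm
  rw [NetSpace.Covers, h]
  exact L.locallyFree

/-! ### The projection `q` of a toric bundle: existence, uniqueness and value on the universal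
trivialization. -/

section Toric

variable {S X : AnalyticSpace K} {f : X ⟶ S} {Λ : Type v} [AddCommGroup Λ]
  {L : LineBundleSystem Λ X} {P : ToricBundle L} {T : SplitTorus S Λ} {u : S ⟶ P.space}

theorem ToricBundle.orbit_proj (P : ToricBundle L) (T : SplitTorus S Λ) (u : S ⟶ P.space) :
    P.orbit T u ≫ P.proj = T.proj ≫ u ≫ P.proj :=
  (P.lift_proj _ _).trans (Category.assoc _ _ _)

theorem Thickening.Hom.orbit_map_proj {P₁ : Thickening u} {T₁ : Thickening T.one}
    (a₁ : T₁.Hom P₁ (P.orbit T u)) :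
    a₁.map ≫ P₁.ι ≫ P.proj = T₁.proj T.proj ≫ u ≫ P.proj := by
  rw [← Category.assoc, a₁.map_ι, Category.assoc, P.orbit_proj, Thickening.proj, Category.assoc]

theorem Thickening.sec_ι_proj (P₁ : Thickening u) : P₁.sec ≫ P₁.ι ≫ P.proj = u ≫ P.proj := by
  rw [← Category.assoc, P₁.sec_ι]

/-- The map `m ↦ a^*m - π^*u^*m` from `j^*p^*(L χ)` to `ω_T ⊗ x^*(L χ)`, where `a` is induced by the
orbit map of `u` and `π` is the projection to `S`. -/
noncomputable def toricProjection (hu : (u ≫ P.proj) ≫ f = 𝟙 S) (P₁ : Thickening u)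
    (T₁ : Thickening T.one) (a₁ : T₁.Hom P₁ (P.orbit T u)) (χ : Λ) :
    ((pullback (P₁.ι ≫ P.proj) (L.L χ)).pushforward (P₁.proj (P.proj ≫ f))).Hom
      (twist (T₁.cotangent T.proj) (u ≫ P.proj) (L.L χ)) :=
  a₁.variation T.proj (P.proj ≫ f) (P.orbit_over f T u hu) (T.lift_proj _ _)
    ((Category.assoc _ _ _).symm.trans hu) (P₁.ι ≫ P.proj) (u ≫ P.proj) a₁.orbit_map_proj
    P₁.sec_ι_proj (L.L χ)

theorem isToricProjection_toricProjection (hu : (u ≫ P.proj) ≫ f = 𝟙 S) (P₁ : Thickening u)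
    (X₁ : Thickening (u ≫ P.proj)) (T₁ : Thickening T.one) (p₁ : P₁.Hom X₁ P.proj)
    (a₁ : T₁.Hom P₁ (P.orbit T u)) (χ : Λ) :
    IsToricProjection hu P₁ X₁ T₁ p₁ a₁ χ (toricProjection hu P₁ T₁ a₁ χ) where
  vanish V m := by
    refine twist_ext fun U ℓ => T₁.cotangent_ext T.proj ?_
    have h₁ := a₁.pre_inf_le (P.orbit_over f T u hu) a₁.orbit_map_proj V U
    have h₂ := P₁.inf_le_pre_sec ((Category.assoc _ _ _).symm.trans hu) P₁.sec_ι_proj V U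
    have hp : Mor.pre (P₁.proj (P.proj ≫ f)) V ⊓ Mor.pre (P₁.ι ≫ P.proj) U ≤
        Mor.pre p₁.map (Mor.pre X₁.ι (Mor.pre f V ⊓ U)) :=
      (inf_le_inf (Mor.le_pre_comp (p₁.map_proj rfl) V) (Mor.le_pre_comp p₁.map_ι U) : _ ≤ _ ⊓ _)
    -- Orbits lie in the fibres of `p`: both morphisms `T₁ → X₁` become `x` after the projection to
    -- `S` when composed with `X₁ → X`.
    have hcomp : (a₁.map ≫ p₁.map) ≫ X₁.ι =
        (T₁.proj T.proj ≫ P₁.sec ≫ p₁.map) ≫ X₁.ι := by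
      rw [Category.assoc, Category.assoc, p₁.map_ι, a₁.orbit_map_proj, Category.assoc,
        p₁.map_ι, P₁.sec_ι_proj]
    suffices h : ∀ μ : X₁.space.sec (Mor.pre X₁.ι (Mor.pre f V ⊓ U)),
        Mor.pullRes a₁.map _ _ h₁ (Mor.pullRes p₁.map _ _ hp μ) =
          Mor.pull (T₁.proj T.proj) _ (Mor.pullRes P₁.sec _ _ h₂ (Mor.pullRes p₁.map _ _ hp μ)) from
      sub_eq_zero.2 (h (pullback.coord m ℓ))
    intro μ
    rw [← Mor.pullRes_self (T₁.proj T.proj) _ le_rfl,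
      Mor.pullRes_comp a₁.map p₁.map _ rfl hp h₁ (h₁.trans (Mor.pre_mono _ hp)),
      Mor.pullRes_comp P₁.sec p₁.map _ rfl hp h₂ (h₂.trans (Mor.pre_mono _ hp))]
    have hle : Mor.pre (T₁.proj T.proj) (V ⊓ Mor.pre (u ≫ P.proj) U) ≤
        Mor.pre (T₁.proj T.proj ≫ P₁.sec ≫ p₁.map) (Mor.pre X₁.ι (Mor.pre f V ⊓ U)) :=
      Mor.pre_mono (T₁.proj T.proj) (h₂.trans (Mor.pre_mono _ hp))
    exact (X₁.isClosedImmersion_ι.pullRes_eq hcomp _ hle μ).trans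
      (Mor.pullRes_comp (T₁.proj T.proj) (P₁.sec ≫ p₁.map) _ rfl _ le_rfl hle μ).symm
  form V φ m := by
    refine twist_ext fun U ℓ => T₁.cotangent_ext T.proj ?_
    have hhg := T.lift_proj (𝟙 S) 1
    have hu' : u ≫ P.proj ≫ f = 𝟙 S := (Category.assoc _ _ _).symm.trans hu
    have h₁ := a₁.pre_inf_le (P.orbit_over f T u hu) a₁.orbit_map_proj V U
    have h₂ := P₁.inf_le_pre_sec hu' P₁.sec_ι_proj V U
    set ω := (T₁.cotangent T.proj).res (inf_le_left : V ⊓ Mor.pre (u ≫ P.proj) U ≤ V)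
      (a₁.pullForm T.proj (P.proj ≫ f) (P.orbit_over f T u hu) φ)
    set c := pullback.coord m ℓ
    set ψ := P₁.space.res inf_le_left (P₁.toFun (P.proj ≫ f) φ)
    have hψa : Mor.pullRes a₁.map _ _ h₁ ψ = T₁.toFun T.proj ω := by
      refine (Mor.pullRes_of_res a₁.map inf_le_left h₁ _).trans ?_
      exact (Mor.res_pullRes a₁.map _ _ _).symm
    have hψs : Mor.pullRes P₁.sec _ _ h₂ ψ = 0 := by
      refine (Mor.pullRes_of_res P₁.sec inf_le_left h₂ _).trans ?_
      rw [← Mor.res_pull, P₁.pull_toFun, map_zero]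
    -- The product of the form `a^*φ` and the difference `a^*c - π^*u^*c` vanishes, both factors
    -- being in the square-zero ideal; this allows `a^*c` to be replaced by `π^*u^*c`.
    have hω2 := T₁.toFun_mul_toFun T.proj ω (a₁.variationFun T.proj hhg h₁ h₂ c)
    change Mor.pullRes a₁.map _ _ h₁ (ψ * c) -
        Mor.pull (T₁.proj T.proj) _ (Mor.pullRes P₁.sec _ _ h₂ (ψ * c)) =
      Mor.pull (T₁.proj T.proj) _ (Mor.pullRes P₁.sec _ _ h₂ c) * T₁.toFun T.proj ω
    rw [map_mul, map_mul, hψs, zero_mul, map_zero, sub_zero, hψa, mul_comm _ (T₁.toFun T.proj ω),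
      ← sub_eq_zero, ← mul_sub]
    exact hω2

/-- The conditions determine the values of `q` over the domain of a frame: there, a section is
the sum of a pull-back from `X₁` and a multiple of the frame by a function that vanishes on `S`. -/
theorem IsToricProjection.map_eq_of_frame {hu : (u ≫ P.proj) ≫ f = 𝟙 S} {P₁ : Thickening u}
    {X₁ : Thickening (u ≫ P.proj)} {T₁ : Thickening T.one} {p₁ : P₁.Hom X₁ P.proj}
    {a₁ : T₁.Hom P₁ (P.orbit T u)} {χ : Λ}
    {q q' : ((pullback (P₁.ι ≫ P.proj) (L.L χ)).pushforward (P₁.proj (P.proj ≫ f))).Hom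
      (twist (T₁.cotangent T.proj) (u ≫ P.proj) (L.L χ))}
    (h : IsToricProjection hu P₁ X₁ T₁ p₁ a₁ χ q) (h' : IsToricProjection hu P₁ X₁ T₁ p₁ a₁ χ q')
    {U : X.Dom} (ℓ : (L.L χ).Frame U) {W : S.Dom} (hWU : W ≤ Mor.pre (u ≫ P.proj) U)
    (m : (pullback (P₁.ι ≫ P.proj) (L.L χ)).sec (Mor.pre (P₁.proj (P.proj ≫ f)) W)) :
    q.map W m = q'.map W m := by
  have hu' : u ≫ P.proj ≫ f = 𝟙 S := (Category.assoc _ _ _).symm.trans hu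
  -- Smallness on `S` alone suffices: the thickening has the points of `S`, so the frame `ℓ` is
  -- available on all of `X₁` above `W`.
  have hX : Mor.pre (X₁.proj f) W ≤ Mor.pre X₁.ι U :=
    (Mor.pre_mono _ hWU).trans (X₁.pre_proj_pre_le f hu U)
  have hp : p₁.map ≫ X₁.proj f = P₁.proj (P.proj ≫ f) := p₁.map_proj rfl
  have hpW := Mor.le_pre_comp hp W
  have hP : Mor.pre (P₁.proj (P.proj ≫ f)) W ≤ Mor.pre (P₁.ι ≫ P.proj) U := by
    rw [← p₁.map_ι]
    exact hpW.trans (Mor.pre_mono p₁.map hX)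
  obtain ⟨c, hc⟩ := exists_smul_pullFrame (P₁.ι ≫ P.proj) (L.L χ) ℓ hP m
  have hsec := P₁.le_pre_sec_pre_proj _ hu' W
  -- `c₀` is the restriction of `c` to `S`; its multiple `m₀` of the frame on `X₁` is the part of
  -- `m` that `q` must kill.
  set c₀ := Mor.pullRes P₁.sec _ W hsec c
  set m₀ := Mor.pull (X₁.proj f) W c₀ • pullFrame X₁.ι (L.L χ) ℓ _ hX
  have hpull := pullSec_smul p₁.map X₁.ι (P₁.ι ≫ P.proj) p₁.map_ι (L.L χ) hpW
    (Mor.pull (X₁.proj f) W c₀) (pullFrame X₁.ι (L.L χ) ℓ _ hX)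
  rw [pullSec_pullFrame _ _ _ _ _ _ _ _ hP] at hpull
  have hcomp : Mor.pullRes p₁.map _ (Mor.pre (P₁.proj (P.proj ≫ f)) W) hpW
      (Mor.pull (X₁.proj f) W c₀) = Mor.pull (P₁.proj (P.proj ≫ f)) W c₀ := by
    rw [← Mor.pullRes_self (X₁.proj f) _ le_rfl, Mor.pullRes_comp _ _ _ hp _ _ le_rfl,
      Mor.pullRes_self]
  rw [hcomp] at hpull
  have hker : Mor.pull P₁.sec (Mor.pre (P₁.proj (P.proj ≫ f)) W)
      (c - Mor.pull (P₁.proj (P.proj ≫ f)) W c₀) = 0 := by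
    have hle := P₁.pre_sec_pre_proj_le _ hu' W
    have h2 := Mor.pullRes_comp P₁.sec (P₁.proj (P.proj ≫ f)) _ (P₁.sec_proj _ hu') (U := W)
      le_rfl le_rfl hle c₀
    rw [Mor.pullRes_self, Mor.pullRes_self] at h2
    rw [map_sub, sub_eq_zero]
    exact (h2.trans ((Mor.pullRes_id (𝟙 S) rfl hle hle _).trans ((Mor.res_pullRes _ _ _ _).trans
      (Mor.pullRes_self P₁.sec _ le_rfl c)))).symm
  -- `c = (c - π^*c₀) + π^*c₀`, where here `π` is the projection `P₁ → S`; the first term vanishes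
  -- on `S`, so `form` governs it, and `vanish` governs the second.
  have hdec : m = (P₁.toFun (P.proj ≫ f) (P₁.ofFun (P.proj ≫ f) _ hker) •
      pullFrame (P₁.ι ≫ P.proj) (L.L χ) ℓ _ hP) +
      pullSec p₁.map X₁.ι (P₁.ι ≫ P.proj) p₁.map_ι (L.L χ) hpW m₀ := by
    rw [hpull, P₁.toFun_ofFun, hc, ← add_smul, sub_add_cancel]
  have e := h.form W (P₁.ofFun (P.proj ≫ f) _ hker)
    (pullFrame (P₁.ι ≫ P.proj) (L.L χ) ℓ _ hP)
  have e' := h'.form W (P₁.ofFun (P.proj ≫ f) _ hker)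
    (pullFrame (P₁.ι ≫ P.proj) (L.L χ) ℓ _ hP)
  rw [hdec]
  refine ((q.map W).map_add _ _).trans (Eq.trans ?_ ((q'.map W).map_add _ _).symm)
  exact congrArg₂ (· + ·) (e.trans e'.symm) ((h.vanish W m₀).trans (h'.vanish W m₀).symm)

/-- Sections of the target are determined locally on `S`, and the inverse images under `x` of
domains of frames cover `S`, so the local computation suffices. -/
theorem IsToricProjection.unique {hu : (u ≫ P.proj) ≫ f = 𝟙 S} {P₁ : Thickening u}
    {X₁ : Thickening (u ≫ P.proj)} {T₁ : Thickening T.one} {p₁ : P₁.Hom X₁ P.proj}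
    {a₁ : T₁.Hom P₁ (P.orbit T u)} {χ : Λ}
    {q q' : ((pullback (P₁.ι ≫ P.proj) (L.L χ)).pushforward (P₁.proj (P.proj ≫ f))).Hom
      (twist (T₁.cotangent T.proj) (u ≫ P.proj) (L.L χ))}
    (h : IsToricProjection hu P₁ X₁ T₁ p₁ a₁ χ q) (h' : IsToricProjection hu P₁ X₁ T₁ p₁ a₁ χ q') :
    q = q' := by
  refine PreMod.Hom.ext (funext fun V => LinearMap.ext fun m => ?_)
  refine T₁.twist_eq_of_covers T.proj _ _
    ((Mor.covers_preimage (u ≫ P.proj) (L.L χ).covers_frame).inter (Z := V) fun _ _ => trivial) ?_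
  rintro _ ⟨_, ⟨U, ⟨ℓ⟩, rfl⟩, rfl⟩ hW
  rw [← q.map_res, ← q'.map_res]
  exact h.map_eq_of_frame h' ℓ inf_le_left _

/-- The universal trivialization, pulled back along the orbit map: `⟨χ, t u⟩ = χ(t) ⟨χ, u⟩`. -/
theorem ToricBundle.pullRes_orbit (P : ToricBundle L) (T : SplitTorus S Λ) (u : S ⟶ P.space)
    (χ : Λ) {U : X.Dom} (ℓ : (L.L χ).Frame U) {W : T.space.Dom}
    (hW : W ≤ Mor.pre (P.orbit T u) (⊤ ⊓ Mor.pre P.proj U))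
    (hW' : W ≤ Mor.pre (T.proj ≫ u) (⊤ ⊓ Mor.pre P.proj U)) :
    Mor.pullRes (P.orbit T u) _ W hW (pullback.coord (P.univ.triv χ) ℓ) =
      T.space.res le_top (T.char (Multiplicative.ofAdd χ) : T.space.sec ⊤) *
        Mor.pullRes (T.proj ≫ u) _ W hW' (pullback.coord (P.univ.triv χ) ℓ) := by
  -- The orbit map is the identity point of `T` acting on the constant point `u`, and the universal
  -- property computes the trivializations of the result.
  have h := P.pull_lift ((T.proj ≫ u) ≫ P.proj) ((P.univ.pull (T.proj ≫ u) _ rfl).smul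
    ((Units.map (Mor.pullTop (𝟙 T.space) : _ →* _)).comp T.char))
  have h1 := congrArg (fun t => pullback.coord (TrivSystem.triv t χ) ℓ) h
  have h2 : Mor.pullTop (𝟙 T.space) (T.char (Multiplicative.ofAdd χ) : T.space.sec ⊤) =
      T.char (Multiplicative.ofAdd χ) := T.space.res_id _ _
  have hle : W ≤ ⊤ ⊓ Mor.pre ((T.proj ≫ u) ≫ P.proj) U := le_inf le_top
    (hW'.trans (Mor.pre_mono _ inf_le_right))
  refine (Mor.res_pullRes (P.orbit T u) _ hle _).symm.trans
    ((congrArg (T.space.res hle) h1).trans ((map_mul (T.space.res hle) _ _).trans ?_))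
  refine congrArg₂ (· * ·) ?_ (Mor.res_pullRes _ _ _ _)
  exact (T.space.res_res _ _ _).trans (congrArg _ h2)

/-- The form `χ^*(dz/z)` is the class of the function `χ - 1`. -/
theorem SplitTorus.toFun_pullForm_dlog {T₁ : Thickening T.one} {G : MultGroup S}
    {G₁ : Thickening G.one} {χ : Λ} (c₁ : T₁.Hom G₁ (T.character G χ)) :
    T₁.toFun T.proj (c₁.pullForm T.proj G.proj (G.lift_proj T.proj _) (G.dlog G₁)) =
      Mor.pullRes T₁.ι ⊤ (Mor.pre (T₁.proj T.proj) ⊤) (fun _ _ => trivial)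
        (T.char (Multiplicative.ofAdd χ) : T.space.sec ⊤) - 1 := by
  have hz : Units.map (Mor.pullTop G.one : G.space.sec ⊤ →* S.sec ⊤) G.z = 1 := G.pull_lift (𝟙 S) 1
  have hz1 : Mor.pullTop G.one (G.z : G.space.sec ⊤) = 1 := congrArg Units.val hz
  have hz2 : Mor.pullTop G.one ((G.z⁻¹ : (G.space.sec ⊤)ˣ) : G.space.sec ⊤) = 1 := by
    have h : Units.map (Mor.pullTop G.one : G.space.sec ⊤ →* S.sec ⊤) G.z⁻¹ = 1 := by rw [map_inv, hz, inv_one]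
    exact congrArg Units.val h
  have hd : G₁.toFun G.proj (G.dlog G₁) = Mor.pullRes G₁.ι ⊤ (Mor.pre (G₁.proj G.proj) ⊤)
      (fun _ _ => trivial) (G.z : G.space.sec ⊤) - 1 := by
    -- At the neutral section `z` is `1`, so the factor `z⁻¹` disappears and the constant subtracted
    -- in `dz` is `1`.
    rw [MultGroup.dlog, G₁.toFun_smul, hz2, map_one, one_mul]
    refine (G₁.toFun_d G.proj (G.lift_proj (𝟙 S) 1) _).trans ?_
    rw [hz1, map_one]
  have hχ : Units.map (Mor.pullTop (T.character G χ) : G.space.sec ⊤ →* T.space.sec ⊤) G.z =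
      T.char (Multiplicative.ofAdd χ) := G.pull_lift T.proj _
  have hχ' : Mor.pullTop (T.character G χ) (G.z : G.space.sec ⊤) =
      T.char (Multiplicative.ofAdd χ) := congrArg Units.val hχ
  refine (c₁.toFun_pullForm T.proj G.proj (G.lift_proj T.proj _) _).trans ?_
  rw [hd, map_sub, map_one, ← hχ',
    Mor.pullRes_comp c₁.map G₁.ι _ c₁.map_ι (U := ⊤) (fun _ _ => trivial) _
      (fun _ _ => trivial)]
  refine congrArg (· - 1) ?_
  exact (Mor.pullRes_comp T₁.ι (T.character G χ) _ rfl (U := ⊤) (V := ⊤) (fun _ _ => trivial) _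
    (fun _ _ => trivial) _).symm

theorem toricProjection_pairing (hu : (u ≫ P.proj) ≫ f = 𝟙 S) (P₁ : Thickening u)
    (T₁ : Thickening T.one) (a₁ : T₁.Hom P₁ (P.orbit T u)) (χ : Λ) (G : MultGroup S)
    (G₁ : Thickening G.one) (c₁ : T₁.Hom G₁ (T.character G χ)) :
    (toricProjection hu P₁ T₁ a₁ χ).map ⊤
        (P.pairing χ P₁.ι (Mor.pre (P₁.proj (P.proj ≫ f)) ⊤)) =
      tmul (c₁.pullForm T.proj G.proj (G.lift_proj T.proj _) (G.dlog G₁))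
        (P.pairing χ u ⊤) := by
  refine twist_ext fun U ℓ => T₁.cotangent_ext T.proj ?_
  have h₁ := a₁.pre_inf_le (P.orbit_over f T u hu) a₁.orbit_map_proj ⊤ U
  have h₂ := P₁.inf_le_pre_sec ((Category.assoc _ _ _).symm.trans hu) P₁.sec_ι_proj ⊤ U
  have hι : Mor.pre (P₁.proj (P.proj ≫ f)) ⊤ ⊓ Mor.pre (P₁.ι ≫ P.proj) U ≤
      Mor.pre P₁.ι (⊤ ⊓ Mor.pre P.proj U) := inf_le_inf_right _ le_top
  have hW : ⊤ ⊓ Mor.pre (u ≫ P.proj) U ≤ Mor.pre u (⊤ ⊓ Mor.pre P.proj U) := le_rfl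
  have horb : Mor.pre T.proj (⊤ ⊓ Mor.pre (u ≫ P.proj) U) ≤
      Mor.pre (P.orbit T u) (⊤ ⊓ Mor.pre P.proj U) :=
    (inf_le_inf le_top (Mor.le_pre_comp (P.orbit_proj T u) U) :
      Mor.pre T.proj ⊤ ⊓ Mor.pre (T.proj ≫ u ≫ P.proj) U ≤
        Mor.pre (P.orbit T u) ⊤ ⊓ Mor.pre (P.orbit T u) (Mor.pre P.proj U))
  have hTu : Mor.pre T.proj (⊤ ⊓ Mor.pre (u ≫ P.proj) U) ≤
      Mor.pre (T.proj ≫ u) (⊤ ⊓ Mor.pre P.proj U) := le_rfl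
  set τ := pullback.coord (P.univ.triv χ) ℓ
  have e1 : Mor.pullRes a₁.map _ _ h₁ (Mor.pullRes P₁.ι _ _ hι τ) =
      Mor.pull T₁.ι _ (Mor.pullRes (P.orbit T u) _ _ horb τ) := by
    rw [← Mor.pullRes_self T₁.ι _ le_rfl,
      Mor.pullRes_comp a₁.map P₁.ι _ a₁.map_ι hι h₁ (Mor.pre_mono T₁.ι horb)]
    exact (Mor.pullRes_comp T₁.ι (P.orbit T u) _ rfl horb le_rfl _ τ).symm
  have e2 : Mor.pullRes P₁.sec _ _ h₂ (Mor.pullRes P₁.ι _ _ hι τ) = Mor.pullRes u _ _ hW τ :=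
    Mor.pullRes_comp P₁.sec P₁.ι u P₁.sec_ι hι h₂ hW τ
  have e3 : Mor.pull T₁.ι _ (Mor.pullRes (T.proj ≫ u) _ _ hTu τ) =
      Mor.pull (T₁.proj T.proj) _ (Mor.pullRes u _ _ hW τ) := by
    rw [← Mor.pullRes_self T₁.ι _ le_rfl, ← Mor.pullRes_self (T₁.proj T.proj) _ le_rfl]
    exact (Mor.pullRes_comp T₁.ι (T.proj ≫ u) _ rfl hTu le_rfl le_rfl τ).trans
      (Mor.pullRes_comp (T₁.proj T.proj) u _ rfl hW le_rfl le_rfl τ).symm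
  have e4 : Mor.pull T₁.ι (Mor.pre T.proj (⊤ ⊓ Mor.pre (u ≫ P.proj) U))
      (T.space.res le_top (T.char (Multiplicative.ofAdd χ) : T.space.sec ⊤)) =
      T₁.space.res (Mor.pre_mono (T₁.proj T.proj) inf_le_left)
        (Mor.pullRes T₁.ι ⊤ (Mor.pre (T₁.proj T.proj) ⊤) (fun _ _ => trivial)
          (T.char (Multiplicative.ofAdd χ) : T.space.sec ⊤)) :=
    (Mor.pull_res T₁.ι le_top _).trans (Mor.res_pullRes T₁.ι _ _ _).symm
  change Mor.pullRes a₁.map _ _ h₁ (Mor.pullRes P₁.ι _ _ hι τ) -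
      Mor.pull (T₁.proj T.proj) _ (Mor.pullRes P₁.sec _ _ h₂ (Mor.pullRes P₁.ι _ _ hι τ)) =
    Mor.pull (T₁.proj T.proj) _ (Mor.pullRes u _ _ hW τ) *
      T₁.space.res (Mor.pre_mono (T₁.proj T.proj) inf_le_left) (T₁.toFun T.proj
        (c₁.pullForm T.proj G.proj (G.lift_proj T.proj _) (G.dlog G₁)))
  have e5 := P.pullRes_orbit T u χ ℓ horb hTu
  -- The difference is `χ · π^*⟨χ, u⟩ - π^*⟨χ, u⟩ = (χ - 1) · π^*⟨χ, u⟩` in the coordinate given by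
  -- `ℓ`.
  rw [e1, e2, e5, map_mul, e3, e4, SplitTorus.toFun_pullForm_dlog, map_sub, map_one, mul_sub,
    mul_one, mul_comm]
  rfl

end Toric

end Berkovich

theorem mainTheorem10 {K : Type u} [NontriviallyNormedField K] [IsUltrametricDist K]
    [CompleteSpace K] {S X : Berkovich.AnalyticSpace K} (f : X ⟶ S)
    {Λ : Type v} [AddCommGroup Λ] [Module.Free ℤ Λ] [Module.Finite ℤ Λ]
    (L : Berkovich.LineBundleSystem Λ X) (P : Berkovich.ToricBundle L)
    (T : Berkovich.SplitTorus S Λ) (G : Berkovich.MultGroup S)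
    (u : S ⟶ P.space) (hu : (u ≫ P.proj) ≫ f = 𝟙 S)
    (P₁ : Berkovich.Thickening u) (X₁ : Berkovich.Thickening (u ≫ P.proj))
    (T₁ : Berkovich.Thickening T.one) (G₁ : Berkovich.Thickening G.one)
    (p₁ : P₁.Hom X₁ P.proj) (a₁ : T₁.Hom P₁ (P.orbit T u)) (χ : Λ)
    (c₁ : T₁.Hom G₁ (T.character G χ)) :
    ∃ q : ((Berkovich.pullback (P₁.ι ≫ P.proj) (L.L χ)).pushforward
          (P₁.proj (P.proj ≫ f))).Hom
        (Berkovich.twist (T₁.cotangent T.proj) (u ≫ P.proj) (L.L χ)),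
      Berkovich.IsToricProjection hu P₁ X₁ T₁ p₁ a₁ χ q ∧
      (∀ q', Berkovich.IsToricProjection hu P₁ X₁ T₁ p₁ a₁ χ q' → q' = q) ∧
      q.map ⊤ (P.pairing χ P₁.ι (Berkovich.Mor.pre (P₁.proj (P.proj ≫ f)) ⊤)) =
        Berkovich.tmul
          (c₁.pullForm T.proj G.proj (G.lift_proj T.proj _) (G.dlog G₁))
          (P.pairing χ u ⊤) := by
  have hq := Berkovich.isToricProjection_toricProjection hu P₁ X₁ T₁ p₁ a₁ χ
  exact ⟨_, hq, fun _ hq' => hq'.unique hq,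
    Berkovich.toricProjection_pairing hu P₁ T₁ a₁ χ G G₁ c₁⟩
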